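/- Let $\Lambda$ be the vertex set of a connected graph with graph distance $\mathsf d$, let $R\subseteq\Lambda$ be a finite non-empty region of volume $V_*=|R|$, and consider operators on $(\mathbb C^D)^{\otimes R}$, $D\ge 2$, with operator norm $\|\cdot\|$. For $S\subseteq R$ put $\operatorname{diam}S=\max_{x,y\in S}\mathsf d(x,y)$. A decomposition of an operator $O$ is a family $(O_S)_{\emptyset\neq S\subseteq R}$ with $O=\sum_S O_S$ and $O_S$ supported within $S$. Define $$\operatorname{rng}(O)=\inf_{\{O_S\}}\ \sup_{S:\,O_S\ne 0}\operatorname{diam}S,\qquad \|O\|_\kappa=\inf_{\{O_S\}}\ \sup_{v\in R}\ \sum_{S\ni v}e^{\kappa\operatorname{diam}S}\,\|O_S\|\quad(\kappa\ge 0),$$ the infima being over decompositions of $O$. Let $H_0$ be a sum of pairwise commuting Hermitian terms, each supported within a set of diameter at most $k$ (for instance $H_0=\sum_{\operatorname{diam} I\le k}h_IZ_I$ with products $Z_I$ of Pauli-$Z$ operators). Suppose that $H_0$ has no repeated eigenvalue, let $\Delta>0$ be the smallest distance between two distinct eigenvalues of $H_0$, and let $\|H_0\|_{\kappa=0}\le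 h$. Let $V_1,V_2,\dots$ be Hermitian operators with $\operatorname{rng}(V_r)\le r$ and $\sum_{r\ge1}\|V_r\|_{\kappa=0}\le h$, and write $$V_\epsilon=\sum_{r\ge1}\epsilon^rV_r,\qquad H=H_0+V_\epsilon,\qquad A=32\pi^2\Big(\frac{V_*h}{\Delta}\Big)^2,\qquad \tilde\epsilon=A\epsilon .$$ Then there are operators $T_1,T_2,\dots$, independent of $\epsilon$ and with vanishing diagonal in the eigenbasis of $H_0$, such that for every $\epsilon>0$ with $\tilde\epsilon\le1$: the series $V_\epsilon$ and $T=\sum_{q\ge1}\epsilon^qT_q$ converge absolutely in operator norm; $T$ is anti-Hermitian, so that $e^T$ is unitary; $e^{T}He^{-T}$ is diagonal in the eigenbasis of $H_0$; and $$\|T\|_\kappa<1\qquad\text{for}\qquad \kappa=\frac{1}{5k+1}\log\big(\tilde\epsilon^{-1}\big).$$ -/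

import Mathlib

open scoped Matrix Matrix.Norms.L2Operator

noncomputable section

namespace SchriefferWolff

/-- Operators on `(ℂ^D)^{⊗ R}`: one `D`-level system (qudit) on every vertex of the finite region
`R`. Basis states are the configurations `R → Fin D`. The norm `‖·‖` in force is the operator
norm (largest singular value). -/
abbrev Op {Λ : Type*} (R : Finset Λ) (D : ℕ) : Type _ :=
  Matrix (R → Fin D) (R → Fin D) ℂ

/-- Diameter of a set of sites of the region, in the distance of the ambient graph. -/
def diam {Λ : Type*} (G : SimpleGraph Λ) {R : Finset Λ} (S : Finset R) : ℕ :=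
  (S ×ˢ S).sup fun p => G.dist (p.1 : Λ) (p.2 : Λ)

section

variable {Λ : Type*} [DecidableEq Λ] {R : Finset Λ} {D : ℕ}

/-- `X` is supported within `S`: it has the form `Y ⊗ 1`, with `Y` acting on the sites of `S`. -/
def SupportedOn (S : Finset R) (X : Op R D) : Prop :=
  ∃ Y : Matrix (S → Fin D) (S → Fin D) ℂ, ∀ σ τ : R → Fin D,
    X σ τ = if (∀ i, i ∉ S → σ i = τ i) then Y (fun i => σ i) (fun i => τ i) else 0

/-- `O = ∑_S X_S` over non-empty sets of sites, with `X_S` supported within `S`. Sets that do not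
occur in the decomposition have `X_S = 0`. -/
def IsDecomposition (O : Op R D) (X : Finset R → Op R D) : Prop :=
  (∀ S, SupportedOn S (X S)) ∧ X ∅ = 0 ∧ ∑ S, X S = O

/-- `rng(O)`: infimum over decompositions `O = ∑_S X_S` of the largest diameter that occurs. -/
def opRange (G : SimpleGraph Λ) (O : Op R D) : ℕ :=
  sInf {r | ∃ X, IsDecomposition O X ∧ ∀ S, X S ≠ 0 → diam G S ≤ r}

/-- The `κ`-norm: infimum over decompositions `O = ∑_S X_S` of
`sup_v ∑_{S ∋ v} e^{κ diam S} ‖X_S‖`. -/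
def kappaNorm (G : SimpleGraph Λ) (κ : ℝ) (O : Op R D) : ℝ :=
  ⨅ X : {X : Finset R → Op R D // IsDecomposition O X},
    ⨆ v : R, ∑ S : Finset R with v ∈ S, Real.exp (κ * diam G S) * ‖X.1 S‖

/-- `H` is a sum of pairwise commuting Hermitian terms, each supported within a set of diameter at
most `k`. In particular every `∑_{diam I ≤ k} h_I Z_I`, with `Z_I` a product of Pauli `Z`
operators on `I`, is of this kind. -/
def IsCommutingLocal (G : SimpleGraph Λ) (k : ℕ) (H : Op R D) : Prop :=
  ∃ X : Finset R → Op R D,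
    (∀ I, SupportedOn I (X I)) ∧ (∀ I, (X I).IsHermitian) ∧ (∀ I J, Commute (X I) (X J)) ∧
    (∀ I, X I ≠ 0 → diam G I ≤ k) ∧ ∑ I, X I = H

end

section

variable {n : Type*} [Fintype n] [DecidableEq n] {H : Matrix n n ℂ}

/-- No eigenvalue is repeated (`eigenvalues` lists them with multiplicity). -/
def IsNondegenerate (hH : H.IsHermitian) : Prop :=
  Function.Injective hH.eigenvalues

/-- The smallest distance between two eigenvalues (listed with multiplicity). -/
def minimalGap (hH : H.IsHermitian) : ℝ :=
  ⨅ p : {p : n × n // p.1 ≠ p.2}, |hH.eigenvalues p.1.1 - hH.eigenvalues p.1.2|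

/-- The matrix of the operator `M` in the orthonormal eigenbasis of `H`. -/
def inEigenbasis (hH : H.IsHermitian) (M : Matrix n n ℂ) : Matrix n n ℂ :=
  (hH.eigenvectorUnitary : Matrix n n ℂ)ᴴ * M * (hH.eigenvectorUnitary : Matrix n n ℂ)

end

/-- The sum `∑_{q ≥ 1} ε^q X_q` of a power series without constant term. -/
def powerSeries {n : Type*} (X : ℕ+ → Matrix n n ℂ) (ε : ℝ) : Matrix n n ℂ :=
  ∑' q : ℕ+, ε ^ (q : ℕ) • X q

end SchriefferWolff

end

/-! Let `L` divide the matrix elements in the eigenbasis of `H₀` by `E_i - E_j` (and kill the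
diagonal), and let `off` remove the diagonal. With `T = L K` one has `[T, H₀] = -off K`, and
expanding in nested commutators gives `e^T (H₀ + V) e^{-T} = H₀ - off K + V + ∑_{m ≥ 0} (ad_T^{m+1}
V / (m+1)! - ad_T^{m+1} (off K) / (m+2)!)`. If `K` equals `V` plus the sum, the right side is `H₀ +
K - off K`, which is diagonal. This fixed-point equation is solved order by order in `ε`, since a
commutator at order `q` involves only lower orders (`swMap_swSeries`, `exp_conj_swSeries`).

Convergence is measured by `∑ b^q ‖f_q‖` in the Frobenius norm, for which `L` has norm at most `1/Δ`
because it acts entrywise. The ball of radius twice the norm of `V` is preserved once `16 Δ⁻¹ ‖V‖_b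
≤ 1` (`wnorm_swSeries_le`). Passing from operator to Frobenius norm costs `√N`, with `N = D^{V_*}`.
This is affordable: `N` levels of spacing at least `Δ` inside `[-‖H₀‖, ‖H₀‖]` force `N ≤ 2 V_* h / Δ
+ 1` (`card_le_of_minimalGap_pos`), so `A`, quadratic in `V_* h / Δ`, absorbs every power of `N`
that occurs.

For locality, `L` and `off` are polynomials in the commutator with `H₀`. Since the terms of `H₀`
commute, those not touching the support of an operator never contribute, and the range grows by at
most `2k` (`gapMul_mem_localRange`). Ranges add under commutators, so `K_q` has range at most
`(5k+1) q - 5k` and `T_q` at most `(5k+1) q` (`coeff_swSeries_mem`).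

Finally `T` is split into orthogonal components, one for each set of sites (`exists_components`). A
component on `S` sees only orders with `(5k+1) q ≥ diam S`, so `e^{κ diam S}` turns `ε^q` into at
most `b^q` with `b = 1/A`. Cauchy–Schwarz over the `2^{V_*} ≤ N` components costs another `√N`
(`kappaNorm_evalSeries_lt_one`). -/

noncomputable section

namespace SchriefferWolff

open scoped NNReal ENNReal

/-! ### Frobenius norm and its comparison with the operator norm. -/

section Frobenius

variable {n : Type*} [Fintype n]

/-- The Frobenius (Hilbert–Schmidt) norm. -/
def frob (X : Matrix n n ℂ) : ℝ≥0 :=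
  NNReal.sqrt (∑ i, ∑ j, ‖X i j‖₊ ^ 2)

lemma frob_sq (X : Matrix n n ℂ) : frob X ^ 2 = ∑ i, ∑ j, ‖X i j‖₊ ^ 2 :=
  NNReal.sq_sqrt _

lemma frob_eq_nnnorm (X : Matrix n n ℂ) :
    frob X = @nnnorm _ Matrix.frobeniusSeminormedAddCommGroup.toSeminormedAddGroup.toNNNorm X := by
  rw [Matrix.frobenius_nnnorm_def, frob, NNReal.sqrt_eq_rpow]
  simp

lemma frob_add_le (X Y : Matrix n n ℂ) : frob (X + Y) ≤ frob X + frob Y := by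
  simp only [frob_eq_nnnorm]
  let _ := Matrix.frobeniusSeminormedAddCommGroup (m := n) (n := n) (α := ℂ)
  exact nnnorm_add_le X Y

lemma frob_mul_le (X Y : Matrix n n ℂ) : frob (X * Y) ≤ frob X * frob Y := by
  simp only [frob_eq_nnnorm]
  exact Matrix.frobenius_nnnorm_mul X Y

@[simp] lemma frob_zero : frob (0 : Matrix n n ℂ) = 0 := by simp [frob]

lemma frob_smul (c : ℂ) (X : Matrix n n ℂ) : frob (c • X) = ‖c‖₊ * frob X := by
  rw [← NNReal.sqrt_sq ‖c‖₊, frob, frob, ← NNReal.sqrt_mul]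
  simp [mul_pow, Finset.mul_sum]

@[simp] lemma frob_neg (X : Matrix n n ℂ) : frob (-X) = frob X := by simp [frob]

lemma frob_sub_le (X Y : Matrix n n ℂ) : frob (X - Y) ≤ frob X + frob Y := by
  simpa [sub_eq_add_neg] using frob_add_le X (-Y)

lemma frob_mono {X Y : Matrix n n ℂ} (h : ∀ i j, ‖X i j‖₊ ≤ ‖Y i j‖₊) : frob X ≤ frob Y := by
  unfold frob
  gcongr with i _ j _
  exact h i j

lemma frob_sum_le {ι : Type*} (s : Finset ι) (X : ι → Matrix n n ℂ) :
    frob (∑ i ∈ s, X i) ≤ ∑ i ∈ s, frob (X i) :=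
  Finset.le_sum_of_subadditive _ frob_zero.le frob_add_le s X

lemma frob_inv_natCast_smul_le {r : ℕ} (hr : r ≠ 0) (X : Matrix n n ℂ) : frob ((r : ℂ)⁻¹ • X) ≤ frob X := by
  rw [frob_smul]
  refine mul_le_of_le_one_left (zero_le) ?_
  rw [nnnorm_inv]
  refine inv_le_one_of_one_le₀ ?_
  rw [← NNReal.coe_le_coe]
  simpa using Nat.one_le_iff_ne_zero.2 hr

lemma frob_sq_eq_trace (X : Matrix n n ℂ) : ((frob X : ℝ) : ℂ) ^ 2 = (Xᴴ * X).trace := by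
  have h : ((frob X : ℝ)) ^ 2 = ∑ i, ∑ j, ‖X i j‖ ^ 2 := by
    have := congrArg NNReal.toReal (frob_sq X)
    push_cast at this
    exact this
  rw [← Complex.ofReal_pow, h, Finset.sum_comm]
  push_cast
  simp only [Matrix.trace, Matrix.diag_apply, Matrix.mul_apply, Matrix.conjTranspose_apply]
  refine Finset.sum_congr rfl fun i _ => Finset.sum_congr rfl fun j _ => ?_
  rw [RCLike.star_def, Complex.conj_mul']

variable [DecidableEq n]

lemma nnnorm_le_frob (X : Matrix n n ℂ) : ‖X‖₊ ≤ frob X := by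
  rw [← NNReal.coe_le_coe, coe_nnnorm, Matrix.l2_opNorm_def]
  refine ContinuousLinearMap.opNorm_le_bound _ (by positivity) fun x => ?_
  have h := @Matrix.frobenius_norm_mul n n Unit ℂ _ _ _ _ X (Matrix.replicateCol Unit x.ofLp)
  rw [Matrix.frobenius_norm_replicateCol] at h
  rw [frob_eq_nnnorm]
  have h2 : X * Matrix.replicateCol Unit x.ofLp = Matrix.replicateCol Unit (X *ᵥ x.ofLp) := by
    ext i j; simp [Matrix.mul_apply, Matrix.mulVec, dotProduct]
  rw [h2, Matrix.frobenius_norm_replicateCol] at h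
  exact h

/-- Every column is the image of a unit vector, hence has Euclidean length at most the operator
norm. -/
lemma frob_le_sqrt_card (X : Matrix n n ℂ) :
    frob X ≤ NNReal.sqrt (Fintype.card n) * ‖X‖₊ := by
  rw [← NNReal.sqrt_sq ‖X‖₊, ← NNReal.sqrt_mul, frob]
  apply NNReal.sqrt_le_sqrt.2
  rw [Finset.sum_comm]
  calc ∑ j, ∑ i, ‖X i j‖₊ ^ 2 ≤ ∑ j : n, ‖X‖₊ ^ 2 := by
        refine Finset.sum_le_sum fun j _ => ?_
        have h := Matrix.l2_opNorm_mulVec X (EuclideanSpace.single j (1 : ℂ))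
        rw [PiLp.norm_single, norm_one, mul_one] at h
        rw [← NNReal.coe_le_coe]
        have h3 := pow_le_pow_left₀ (norm_nonneg _) h 2
        rw [EuclideanSpace.norm_sq_eq] at h3
        simpa using h3
    _ = _ := by simp

lemma frob_mul_unitary (U : Matrix.unitaryGroup n ℂ) (X : Matrix n n ℂ) :
    frob ((U : Matrix n n ℂ) * X * (U : Matrix n n ℂ)ᴴ) = frob X := by
  have hU : (U : Matrix n n ℂ)ᴴ * (U : Matrix n n ℂ) = 1 := by
    simpa [Matrix.star_eq_conjTranspose] using Matrix.UnitaryGroup.star_mul_self U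
  have h : ((frob ((U : Matrix n n ℂ) * X * (U : Matrix n n ℂ)ᴴ) : ℝ) : ℂ) ^ 2
      = ((frob X : ℝ) : ℂ) ^ 2 := by
    rw [frob_sq_eq_trace, frob_sq_eq_trace]
    have : ((U : Matrix n n ℂ) * X * (U : Matrix n n ℂ)ᴴ)ᴴ * ((U : Matrix n n ℂ) * X * (U : Matrix n n ℂ)ᴴ)
        = (U : Matrix n n ℂ) * (Xᴴ * X * (U : Matrix n n ℂ)ᴴ) := by
      simp only [Matrix.conjTranspose_mul, Matrix.conjTranspose_conjTranspose, Matrix.mul_assoc]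
      rw [← Matrix.mul_assoc (U : Matrix n n ℂ)ᴴ (U : Matrix n n ℂ), hU, Matrix.one_mul]
    rw [this, Matrix.trace_mul_comm, Matrix.mul_assoc, hU, Matrix.mul_one]
  have h' : (frob ((U : Matrix n n ℂ) * X * (U : Matrix n n ℂ)ᴴ)) ^ 2 = (frob X) ^ 2 := by
    exact_mod_cast h
  exact (pow_left_inj₀ (zero_le) (zero_le) two_ne_zero).1 h'

end Frobenius

/-! ### Multipliers of energy differences in the eigenbasis. -/

section EigenMultiplier

variable {n : Type*} [Fintype n] [DecidableEq n] {H : Matrix n n ℂ} (hH : H.IsHermitian)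

local notation "𝐔" => (Matrix.IsHermitian.eigenvectorUnitary hH : Matrix n n ℂ)

lemma eigenvectorUnitary_conjTranspose_mul : 𝐔ᴴ * 𝐔 = 1 := by
  simpa [Matrix.star_eq_conjTranspose] using
    Matrix.UnitaryGroup.star_mul_self hH.eigenvectorUnitary

lemma eigenvectorUnitary_mul_conjTranspose : 𝐔 * 𝐔ᴴ = 1 :=
  mul_eq_one_comm.1 (eigenvectorUnitary_conjTranspose_mul hH)

lemma inEigenbasis_mul (X Y : Matrix n n ℂ) :
    inEigenbasis hH (X * Y) = inEigenbasis hH X * inEigenbasis hH Y := by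
  simp only [inEigenbasis, Matrix.mul_assoc]
  rw [← Matrix.mul_assoc 𝐔 𝐔ᴴ, eigenvectorUnitary_mul_conjTranspose, Matrix.one_mul]

lemma inEigenbasis_add (X Y : Matrix n n ℂ) :
    inEigenbasis hH (X + Y) = inEigenbasis hH X + inEigenbasis hH Y := by
  simp [inEigenbasis, Matrix.mul_add, Matrix.add_mul]

lemma inEigenbasis_sub (X Y : Matrix n n ℂ) :
    inEigenbasis hH (X - Y) = inEigenbasis hH X - inEigenbasis hH Y := by
  simp [inEigenbasis, Matrix.mul_sub, Matrix.sub_mul]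

lemma inEigenbasis_conjTranspose (X : Matrix n n ℂ) :
    inEigenbasis hH Xᴴ = (inEigenbasis hH X)ᴴ := by
  simp [inEigenbasis, Matrix.mul_assoc]

lemma inEigenbasis_injective : Function.Injective (inEigenbasis hH) := by
  intro X Y h
  have h2 := congrArg (fun Z => 𝐔 * Z * 𝐔ᴴ) h
  simp only [inEigenbasis, Matrix.mul_assoc] at h2
  simpa [← Matrix.mul_assoc, eigenvectorUnitary_mul_conjTranspose] using
    (by simpa [Matrix.mul_assoc, eigenvectorUnitary_mul_conjTranspose] using h2 :
      𝐔 * (𝐔ᴴ * X) = 𝐔 * (𝐔ᴴ * Y))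

lemma inEigenbasis_self :
    inEigenbasis hH H = Matrix.diagonal fun i => (hH.eigenvalues i : ℂ) := by
  have h := hH.conjStarAlgAut_star_eigenvectorUnitary
  rw [Unitary.conjStarAlgAut_apply] at h
  simpa [inEigenbasis, Matrix.star_eq_conjTranspose, Function.comp_def] using h

lemma frob_inEigenbasis (X : Matrix n n ℂ) : frob (inEigenbasis hH X) = frob X := by
  have := frob_mul_unitary (star hH.eigenvectorUnitary) X
  simpa [inEigenbasis, Matrix.star_eq_conjTranspose] using this

/-- The operator that multiplies the `(i, j)` matrix element in the eigenbasis of `H` by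
`f (E_i - E_j)`. -/
def gapMul (f : ℝ → ℂ) : Matrix n n ℂ →ₗ[ℂ] Matrix n n ℂ where
  toFun X := 𝐔 * Matrix.of (fun i j =>
    f (hH.eigenvalues i - hH.eigenvalues j) * inEigenbasis hH X i j) * 𝐔ᴴ
  map_add' X Y := by
    rw [← Matrix.add_mul, ← Matrix.mul_add]
    congr 2
    ext i j
    simp [inEigenbasis_add, mul_add]
  map_smul' c X := by
    rw [RingHom.id_apply, ← Matrix.smul_mul, ← Matrix.mul_smul]
    congr 2
    ext i j
    simp [inEigenbasis, mul_left_comm]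

lemma inEigenbasis_gapMul (f : ℝ → ℂ) (X : Matrix n n ℂ) (i j : n) :
    inEigenbasis hH (gapMul hH f X) i j =
      f (hH.eigenvalues i - hH.eigenvalues j) * inEigenbasis hH X i j := by
  have h : inEigenbasis hH (gapMul hH f X) = Matrix.of (fun i j =>
    f (hH.eigenvalues i - hH.eigenvalues j) * inEigenbasis hH X i j) := by
    simp only [inEigenbasis, gapMul, LinearMap.coe_mk, AddHom.coe_mk]
    simp only [← Matrix.mul_assoc, eigenvectorUnitary_conjTranspose_mul, Matrix.one_mul]
    rw [Matrix.mul_assoc, eigenvectorUnitary_conjTranspose_mul, Matrix.mul_one]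
  rw [h, Matrix.of_apply]

/-- In the eigenbasis the map multiplies entry by entry, so a sup bound on the multiplier suffices.
The operator norm has no such bound, which is why the Frobenius norm is used. -/
lemma frob_gapMul_le {f : ℝ → ℂ} {c : ℝ≥0}
    (hf : ∀ i j, ‖f (hH.eigenvalues i - hH.eigenvalues j)‖₊ ≤ c) (X : Matrix n n ℂ) :
    frob (gapMul hH f X) ≤ c * frob X := by
  rw [← frob_inEigenbasis hH, ← frob_inEigenbasis hH X]
  have hc : c = ‖((c : ℝ) : ℂ)‖₊ := by ext; simp
  rw [hc, ← frob_smul]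
  refine frob_mono fun i j => ?_
  rw [inEigenbasis_gapMul, Matrix.smul_apply, smul_eq_mul, nnnorm_mul, nnnorm_mul, ← hc]
  gcongr
  exact hf i j

lemma commutator_gapMul (f : ℝ → ℂ) (X : Matrix n n ℂ) :
    H * gapMul hH f X - gapMul hH f X * H = gapMul hH (fun x => x * f x) X := by
  apply inEigenbasis_injective hH
  ext i j
  rw [inEigenbasis_sub, inEigenbasis_mul, inEigenbasis_mul, inEigenbasis_self, Matrix.sub_apply,
    Matrix.diagonal_mul, Matrix.mul_diagonal, inEigenbasis_gapMul, inEigenbasis_gapMul]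
  push_cast
  ring

lemma gapMul_conjTranspose (f : ℝ → ℂ) (X : Matrix n n ℂ) :
    (gapMul hH f X)ᴴ = gapMul hH (fun x => star (f (-x))) Xᴴ := by
  apply inEigenbasis_injective hH
  ext i j
  rw [inEigenbasis_conjTranspose, Matrix.conjTranspose_apply, inEigenbasis_gapMul,
    inEigenbasis_gapMul, inEigenbasis_conjTranspose, Matrix.conjTranspose_apply, neg_sub, star_mul']

lemma gapMul_congr {f g : ℝ → ℂ}
    (h : ∀ i j, f (hH.eigenvalues i - hH.eigenvalues j) = g (hH.eigenvalues i - hH.eigenvalues j))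
    (X : Matrix n n ℂ) : gapMul hH f X = gapMul hH g X := by
  apply inEigenbasis_injective hH
  ext i j
  rw [inEigenbasis_gapMul, inEigenbasis_gapMul, h]

/-- The multiplier `x` is the commutator with `H`, so a polynomial multiplier is a polynomial in
that commutator. -/
lemma gapMul_eval_mem (Y : Submodule ℂ (Matrix n n ℂ))
    (hY : ∀ X ∈ Y, H * X - X * H ∈ Y) (p : Polynomial ℂ) {X : Matrix n n ℂ} (hX : X ∈ Y) :
    gapMul hH (fun x => p.eval (x : ℂ)) X ∈ Y := by
  induction p using Polynomial.induction_on with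
  | C a =>
    have : gapMul hH (fun x => (Polynomial.C a).eval (x : ℂ)) X = a • X := by
      apply inEigenbasis_injective hH
      ext i j
      rw [inEigenbasis_gapMul]
      simp [inEigenbasis]
    rw [this]
    exact Y.smul_mem a hX
  | add p q hp hq =>
    have : gapMul hH (fun x => (p + q).eval (x : ℂ)) X =
        gapMul hH (fun x => p.eval (x : ℂ)) X + gapMul hH (fun x => q.eval (x : ℂ)) X := by
      apply inEigenbasis_injective hH
      ext i j
      rw [inEigenbasis_add, Matrix.add_apply, inEigenbasis_gapMul, inEigenbasis_gapMul,
        inEigenbasis_gapMul, Polynomial.eval_add, add_mul]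
    rw [this]
    exact Y.add_mem hp hq
  | monomial m a ih =>
    have h := hY _ ih
    rw [commutator_gapMul] at h
    convert h using 3
    ext x
    simp only [Polynomial.eval_mul, Polynomial.eval_C, Polynomial.eval_pow, Polynomial.eval_X]
    ring

/-- A multiplier in the eigenbasis of `H` preserves every space that the commutator with `H`
preserves, being a polynomial in that commutator. -/
lemma gapMul_mem (f : ℝ → ℂ) (Y : Submodule ℂ (Matrix n n ℂ))
    (hY : ∀ X ∈ Y, H * X - X * H ∈ Y) {X : Matrix n n ℂ} (hX : X ∈ Y) : gapMul hH f X ∈ Y := by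
  let s : Finset ℝ := Finset.univ.image fun p : n × n => hH.eigenvalues p.1 - hH.eigenvalues p.2
  have hinj : Set.InjOn (fun x : ℝ => (x : ℂ)) s := Complex.ofReal_injective.injOn
  -- Only finitely many energy differences occur, so Lagrange interpolation replaces `f` by a
  -- polynomial.
  rw [gapMul_congr hH (g := fun x =>
    (Lagrange.interpolate s (fun x : ℝ => (x : ℂ)) f).eval (x : ℂ))]
  · exact gapMul_eval_mem hH Y hY _ hX
  · intro i j
    rw [Lagrange.eval_interpolate_at_node f hinj]
    exact Finset.mem_image.2 ⟨(i, j), Finset.mem_univ _, rfl⟩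

end EigenMultiplier

/-! ### Conjugation by an exponential as a series of nested commutators. -/

section AdIter

/-- The iterated commutator `[T, [T, … [T, Y]]]` with `m` copies of `T`. -/
def adIter {𝔸 : Type*} [Ring 𝔸] (T Y : 𝔸) (m : ℕ) : 𝔸 :=
  (fun Z => T * Z - Z * T)^[m] Y

variable {𝔸 : Type*} [Ring 𝔸]

@[simp] lemma adIter_zero (T Y : 𝔸) : adIter T Y 0 = Y := rfl

lemma adIter_succ (T Y : 𝔸) (m : ℕ) :
    adIter T Y (m + 1) = T * adIter T Y m - adIter T Y m * T := by
  simp only [adIter, Function.iterate_succ_apply']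

lemma adIter_succ' (T Y : 𝔸) (m : ℕ) : adIter T Y (m + 1) = adIter T (T * Y - Y * T) m := by
  simp only [adIter, Function.iterate_succ_apply]

lemma adIter_neg (T Y : 𝔸) (m : ℕ) : adIter T (-Y) m = -adIter T Y m := by
  induction m with
  | zero => rfl
  | succ m ih => simp only [adIter_succ, ih]; noncomm_ring

/-- `e^T Y e^{-T} = ∑ₘ ad_T^m Y / m!`. -/
lemma hasSum_adIter {𝔸 : Type*} [NormedRing 𝔸] [NormedAlgebra ℂ 𝔸] [CompleteSpace 𝔸] (T Y : 𝔸) :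
    HasSum (fun m : ℕ => (m.factorial : ℂ)⁻¹ • adIter T Y m)
      (NormedSpace.exp T * Y * NormedSpace.exp (-T)) := by
  -- `ad_T` is left multiplication by `T` plus right multiplication by `-T`. These commute, so its
  -- exponential factors.
  let l : 𝔸 →L[ℂ] 𝔸 := ContinuousLinearMap.mul ℂ 𝔸 T
  let r : 𝔸 →L[ℂ] 𝔸 := (ContinuousLinearMap.mul ℂ 𝔸).flip (-T)
  have hlr : Commute l r := by
    ext Z
    simp [l, r, mul_assoc]
  have hl : ∀ (m : ℕ) (Z : 𝔸), (l ^ m) Z = T ^ m * Z := by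
    intro m Z
    induction m with
    | zero => simp
    | succ m ih => rw [pow_succ', mul_apply_eq_comp, ih, pow_succ']; simp [l, mul_assoc]
  have hr : ∀ (m : ℕ) (Z : 𝔸), (r ^ m) Z = Z * (-T) ^ m := by
    intro m Z
    induction m with
    | zero => simp
    | succ m ih =>
      rw [pow_succ', mul_apply_eq_comp, ih, pow_succ]
      simp [r, mul_assoc]
  have ha : ∀ (m : ℕ) (Z : 𝔸), ((l + r) ^ m) Z = adIter T Z m := by
    intro m Z
    induction m with
    | zero => simp
    | succ m ih =>
      rw [pow_succ', mul_apply_eq_comp, ih, adIter_succ]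
      simp [l, r, sub_eq_add_neg]
  have happ : ∀ (A : 𝔸 →L[ℂ] 𝔸) (Z : 𝔸),
      HasSum (fun m : ℕ => (m.factorial : ℂ)⁻¹ • (A ^ m) Z) (NormedSpace.exp A Z) := fun A Z =>
    (NormedSpace.exp_series_hasSum_exp' (𝕂 := ℂ) A).mapL (ContinuousLinearMap.apply ℂ 𝔸 Z)
  have hel : ∀ Z, NormedSpace.exp l Z = NormedSpace.exp T * Z := by
    intro Z
    refine (happ l Z).unique ?_
    have := (NormedSpace.exp_series_hasSum_exp' (𝕂 := ℂ) T).mul_right Z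
    simpa [hl, smul_mul_assoc] using this
  have her : ∀ Z, NormedSpace.exp r Z = Z * NormedSpace.exp (-T) := by
    intro Z
    refine (happ r Z).unique ?_
    have := (NormedSpace.exp_series_hasSum_exp' (𝕂 := ℂ) (-T)).mul_left Z
    simpa only [hr, mul_smul_comm] using this
  have h := happ (l + r) Y
  simp only [ha] at h
  let _ : NormedAlgebra ℚ (𝔸 →L[ℂ] 𝔸) := NormedAlgebra.restrictScalars ℚ ℂ _
  have hexp : NormedSpace.exp (l + r) = NormedSpace.exp l * NormedSpace.exp r :=
    NormedSpace.exp_add_of_commute hlr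
  rw [hexp, mul_apply_eq_comp, her, hel, ← mul_assoc] at h
  exact h

end AdIter

/-! ### Weighted norm and truncation of matrix power series. -/

section WeightedNorm

variable {n : Type*} [Fintype n] [DecidableEq n]

local notation "𝓜" => Matrix n n ℂ

/-- The weighted norm `∑ b^q ‖f_q‖` (Frobenius norm) of a power series with matrix coefficients. -/
def wnorm (b : ℝ≥0) (f : PowerSeries (Matrix n n ℂ)) : ℝ≥0∞ :=
  ∑' q : ℕ, (b : ℝ≥0∞) ^ q * frob (PowerSeries.coeff q f)

variable {b : ℝ≥0}

lemma wnorm_sub_le (f g : PowerSeries 𝓜) : wnorm b (f - g) ≤ wnorm b f + wnorm b g := by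
  rw [wnorm, wnorm, wnorm, ← ENNReal.tsum_add]
  refine ENNReal.tsum_le_tsum fun q => ?_
  rw [← mul_add, map_sub]
  gcongr
  exact_mod_cast frob_sub_le _ _

lemma wnorm_mul_le (f g : PowerSeries 𝓜) : wnorm b (f * g) ≤ wnorm b f * wnorm b g := by
  calc wnorm b (f * g)
      ≤ ∑' q : ℕ, ∑' p : Finset.HasAntidiagonal.antidiagonal q,
        ((b : ℝ≥0∞) ^ p.1.1 * frob (PowerSeries.coeff p.1.1 f)) *
          ((b : ℝ≥0∞) ^ p.1.2 * frob (PowerSeries.coeff p.1.2 g)) := by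
        refine ENNReal.tsum_le_tsum fun q => ?_
        rw [Finset.tsum_subtype (Finset.HasAntidiagonal.antidiagonal q) fun p : ℕ × ℕ =>
          ((b : ℝ≥0∞) ^ p.1 * frob (PowerSeries.coeff p.1 f)) *
          ((b : ℝ≥0∞) ^ p.2 * frob (PowerSeries.coeff p.2 g)), PowerSeries.coeff_mul]
        have h : ∀ p ∈ Finset.HasAntidiagonal.antidiagonal q,
            ((b : ℝ≥0∞) ^ p.1 * frob (PowerSeries.coeff p.1 f)) *
            ((b : ℝ≥0∞) ^ p.2 * frob (PowerSeries.coeff p.2 g)) = (b : ℝ≥0∞) ^ q *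
            ((frob (PowerSeries.coeff p.1 f) * frob (PowerSeries.coeff p.2 g) : ℝ≥0) : ℝ≥0∞) := by
          intro p hp
          rw [← Finset.HasAntidiagonal.mem_antidiagonal.1 hp, pow_add]
          push_cast
          ring
        rw [Finset.sum_congr rfl h, ← Finset.mul_sum]
        gcongr
        exact_mod_cast (frob_sum_le _ _).trans (Finset.sum_le_sum fun p _ => frob_mul_le _ _)
    _ = wnorm b f * wnorm b g := by
        rw [← ENNReal.tsum_sigma' (f := fun s : Σ q : ℕ, Finset.HasAntidiagonal.antidiagonal q =>
          ((b : ℝ≥0∞) ^ s.2.1.1 * frob (PowerSeries.coeff s.2.1.1 f)) *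
          ((b : ℝ≥0∞) ^ s.2.1.2 * frob (PowerSeries.coeff s.2.1.2 g))),
          ← Finset.HasAntidiagonal.sigmaAntidiagonalEquivProd.symm.tsum_eq]
        simp only [Finset.HasAntidiagonal.sigmaAntidiagonalEquivProd_symm_apply_snd_coe]
        rw [ENNReal.tsum_prod']
        simp only [ENNReal.tsum_mul_left, ENNReal.tsum_mul_right]
        rfl

lemma wnorm_adIter_le (T Y : PowerSeries 𝓜) (m : ℕ) :
    wnorm b (adIter T Y m) ≤ (2 * wnorm b T) ^ m * wnorm b Y := by
  induction m with
  | zero => simp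
  | succ m ih =>
    rw [adIter_succ]
    calc _ ≤ _ := wnorm_sub_le _ _
      _ ≤ wnorm b T * wnorm b (adIter T Y m) + wnorm b (adIter T Y m) * wnorm b T :=
        add_le_add (wnorm_mul_le _ _) (wnorm_mul_le _ _)
      _ = 2 * wnorm b T * wnorm b (adIter T Y m) := by ring
      _ ≤ 2 * wnorm b T * ((2 * wnorm b T) ^ m * wnorm b Y) := by gcongr
      _ = _ := by ring

/-- Apply a linear map to every coefficient. -/
def mapCoeff (φ : 𝓜 →ₗ[ℂ] 𝓜) (f : PowerSeries 𝓜) : PowerSeries 𝓜 :=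
  PowerSeries.mk fun q => φ (PowerSeries.coeff q f)

@[simp] lemma coeff_mapCoeff (φ : 𝓜 →ₗ[ℂ] 𝓜) (f : PowerSeries 𝓜) (q : ℕ) :
    PowerSeries.coeff q (mapCoeff φ f) = φ (PowerSeries.coeff q f) :=
  PowerSeries.coeff_mk _ _

lemma wnorm_mapCoeff_le {φ : 𝓜 →ₗ[ℂ] 𝓜} {c : ℝ≥0} (hφ : ∀ X, frob (φ X) ≤ c * frob X)
    (f : PowerSeries 𝓜) : wnorm b (mapCoeff φ f) ≤ c * wnorm b f := by
  rw [wnorm, wnorm, ← ENNReal.tsum_mul_left]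
  refine ENNReal.tsum_le_tsum fun q => ?_
  rw [mul_left_comm, coeff_mapCoeff]
  gcongr
  exact_mod_cast hφ _

/-- `f` and `g` have the same coefficients below `p`. -/
def EqBelow (p : ℕ) (f g : PowerSeries 𝓜) : Prop :=
  ∀ q < p, PowerSeries.coeff q f = PowerSeries.coeff q g

/-- Without constant terms, the coefficient of order `p` in a product uses only factors of order
below `p`; agreement therefore gains one order. -/
lemma EqBelow.mul {p : ℕ} {T T' Y Y' : PowerSeries 𝓜} (hT : EqBelow p T T') (hY : EqBelow p Y Y')
    (h1 : PowerSeries.coeff 0 T = 0) (h2 : PowerSeries.coeff 0 T' = 0)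
    (h3 : PowerSeries.coeff 0 Y = 0) (h4 : PowerSeries.coeff 0 Y' = 0) :
    EqBelow (p + 1) (T * Y) (T' * Y') := by
  intro q hq
  rw [PowerSeries.coeff_mul, PowerSeries.coeff_mul]
  refine Finset.sum_congr rfl fun ⟨i, j⟩ hij => ?_
  rw [Finset.HasAntidiagonal.mem_antidiagonal] at hij
  dsimp only at hij ⊢
  rcases Nat.eq_zero_or_pos i with rfl | hi
  · rw [h1, h2, zero_mul, zero_mul]
  rcases Nat.eq_zero_or_pos j with rfl | hj
  · rw [h3, h4, mul_zero, mul_zero]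
  rw [hT i (by omega), hY j (by omega)]

lemma EqBelow.mono {p p' : ℕ} (hp : p ≤ p') {f g : PowerSeries 𝓜} (h : EqBelow p' f g) :
    EqBelow p f g := fun q hq => h q (hq.trans_le hp)

lemma coeff_zero_adIter {T Y : PowerSeries 𝓜} (hY : PowerSeries.coeff 0 Y = 0)
    (hT : PowerSeries.coeff 0 T = 0) (m : ℕ) : PowerSeries.coeff 0 (adIter T Y m) = 0 := by
  cases m with
  | zero => exact hY
  | succ m => 
    rw [PowerSeries.coeff_zero_eq_constantCoeff] at *
    simp [adIter_succ, hT]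

/-- Each of the `m` copies of `T`, and `Y` itself, carries at least one power of `ε`, so the series
starts at order `m + 1`. This makes the sum over `m` finite at each order. -/
lemma coeff_adIter_of_le {T Y : PowerSeries 𝓜} (hT : PowerSeries.coeff 0 T = 0)
    (hY : PowerSeries.coeff 0 Y = 0) {q m : ℕ} (h : q ≤ m) :
    PowerSeries.coeff q (adIter T Y m) = 0 := by
  induction m generalizing q with
  | zero => simpa [Nat.le_zero.1 h] using hY
  | succ m ih =>
    rw [adIter_succ, map_sub, PowerSeries.coeff_mul, PowerSeries.coeff_mul,
      Finset.sum_eq_zero, Finset.sum_eq_zero, sub_zero]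
    · rintro ⟨i, j⟩ hij
      rw [Finset.HasAntidiagonal.mem_antidiagonal] at hij
      dsimp only at hij ⊢
      rcases Nat.eq_zero_or_pos j with rfl | hj
      · rw [hT, mul_zero]
      · rw [ih (by omega), zero_mul]
    · rintro ⟨i, j⟩ hij
      rw [Finset.HasAntidiagonal.mem_antidiagonal] at hij
      dsimp only at hij ⊢
      rcases Nat.eq_zero_or_pos i with rfl | hi
      · rw [hT, zero_mul]
      · rw [ih (by omega), mul_zero]

lemma EqBelow.adIter {p : ℕ} {T T' Y Y' : PowerSeries 𝓜} (hT : EqBelow p T T')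
    (hY : EqBelow p Y Y')
    (h1 : PowerSeries.coeff 0 T = 0) (h2 : PowerSeries.coeff 0 T' = 0)
    (h3 : PowerSeries.coeff 0 Y = 0) (h4 : PowerSeries.coeff 0 Y' = 0) (m : ℕ) :
    EqBelow (p + 1) (adIter T Y (m + 1)) (adIter T' Y' (m + 1)) := by
  have key : ∀ m, EqBelow p (SchriefferWolff.adIter T Y m) (SchriefferWolff.adIter T' Y' m) →
      EqBelow (p + 1) (SchriefferWolff.adIter T Y (m + 1)) (SchriefferWolff.adIter T' Y' (m + 1)) := by
    intro m hm q hq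
    have z1 := coeff_zero_adIter h3 h1 m
    have z2 := coeff_zero_adIter h4 h2 m
    rw [adIter_succ, adIter_succ, map_sub, map_sub, hT.mul hm h1 h2 z1 z2 q hq,
      hm.mul hT z1 z2 h1 h2 q hq]
  induction m with
  | zero => exact key 0 hY
  | succ m ih => exact key (m + 1) (ih.mono (Nat.le_succ p))

end WeightedNorm

/-! ### The fixed point, order by order, and its norm bound. -/

section FixedPoint

variable {n : Type*} [Fintype n] [DecidableEq n]

local notation "𝓜" => Matrix n n ℂ

variable (L off : Matrix n n ℂ →ₗ[ℂ] Matrix n n ℂ) (V : PowerSeries (Matrix n n ℂ))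

/-- The order-`m + 1` part of the Schrieffer–Wolff map. -/
def swTerm (K : PowerSeries 𝓜) (m q : ℕ) : 𝓜 :=
  ((m + 1).factorial : ℂ)⁻¹ • PowerSeries.coeff q (adIter (mapCoeff L K) V (m + 1)) -
    ((m + 2).factorial : ℂ)⁻¹ • PowerSeries.coeff q (adIter (mapCoeff L K) (mapCoeff off K) (m + 1))

/-- The map whose fixed point `K` makes `T = L K` solve the Schrieffer–Wolff equations. -/
def swMap (K : PowerSeries 𝓜) : PowerSeries 𝓜 :=
  PowerSeries.mk fun q => PowerSeries.coeff q V + ∑ m ∈ Finset.range q, swTerm L off V K m q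

lemma coeff_swMap (K : PowerSeries 𝓜) (q : ℕ) : PowerSeries.coeff q (swMap L off V K) =
    PowerSeries.coeff q V + ∑ m ∈ Finset.range q, swTerm L off V K m q :=
  PowerSeries.coeff_mk _ _

/-- The fixed point of `swMap`. -/
def swSeries : PowerSeries 𝓜 :=
  PowerSeries.mk fun q => PowerSeries.coeff q ((swMap L off V)^[q] 0)

variable {L off V}

lemma coeff_zero_swMap (hV : PowerSeries.coeff 0 V = 0) (K : PowerSeries 𝓜) :
    PowerSeries.coeff 0 (swMap L off V K) = 0 := by
  rw [coeff_swMap, hV]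
  simp

lemma coeff_zero_iterate (hV : PowerSeries.coeff 0 V = 0) (j : ℕ) :
    PowerSeries.coeff 0 ((swMap L off V)^[j] 0) = 0 := by
  cases j with
  | zero => simp
  | succ j => rw [Function.iterate_succ_apply', coeff_zero_swMap hV]

lemma coeff_zero_swSeries : PowerSeries.coeff 0 (swSeries L off V) = 0 := by
  rw [swSeries, PowerSeries.coeff_mk]; simp

lemma EqBelow.swMap (hV : PowerSeries.coeff 0 V = 0) {p : ℕ} {K K' : PowerSeries 𝓜}
    (h : EqBelow p K K') (h1 : PowerSeries.coeff 0 K = 0) (h2 : PowerSeries.coeff 0 K' = 0) :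
    EqBelow (p + 1) (swMap L off V K) (swMap L off V K') := by
  intro q hq
  rw [coeff_swMap, coeff_swMap]
  congr 1
  refine Finset.sum_congr rfl fun m _ => ?_
  have hm : ∀ φ : 𝓜 →ₗ[ℂ] 𝓜, EqBelow p (mapCoeff φ K) (mapCoeff φ K') := fun φ q hq => by
    rw [coeff_mapCoeff, coeff_mapCoeff, h q hq]
  have z1 : ∀ φ : 𝓜 →ₗ[ℂ] 𝓜, PowerSeries.coeff 0 (mapCoeff φ K) = 0 := fun φ => by
    rw [coeff_mapCoeff, h1, map_zero]
  have z2 : ∀ φ : 𝓜 →ₗ[ℂ] 𝓜, PowerSeries.coeff 0 (mapCoeff φ K') = 0 := fun φ => by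
    rw [coeff_mapCoeff, h2, map_zero]
  rw [swTerm, swTerm, (hm L).adIter (fun _ _ => rfl) (z1 L) (z2 L) hV hV m q hq,
    (hm L).adIter (hm off) (z1 L) (z2 L) (z1 off) (z2 off) m q hq]

lemma eqBelow_iterate (hV : PowerSeries.coeff 0 V = 0) {i j : ℕ} (hij : i ≤ j) :
    EqBelow (i + 1) ((swMap L off V)^[i] 0) ((swMap L off V)^[j] 0) := by
  have step : ∀ i, EqBelow (i + 1) ((swMap L off V)^[i] 0) ((swMap L off V)^[i + 1] 0) := by
    intro i
    induction i with
    | zero =>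
      intro q hq
      obtain rfl : q = 0 := by omega
      rw [coeff_zero_iterate hV, coeff_zero_iterate hV]
    | succ i ih =>
      rw [Function.iterate_succ_apply', Function.iterate_succ_apply']
      exact ih.swMap hV (coeff_zero_iterate hV _) (coeff_zero_iterate hV _)
  induction j, hij using Nat.le_induction with
  | base => exact fun _ _ => rfl
  | succ j hij ih => exact fun q hq => (ih q hq).trans (step j q (by omega))

lemma eqBelow_swSeries (hV : PowerSeries.coeff 0 V = 0) (j : ℕ) :
    EqBelow (j + 1) (swSeries L off V) ((swMap L off V)^[j] 0) := by
  intro q hq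
  rw [swSeries, PowerSeries.coeff_mk]
  exact eqBelow_iterate hV (by omega) q (by omega)

/-- Each application of `swMap` makes one more coefficient final, so order `q` of the diagonal
sequence of iterates is already stationary. -/
lemma swMap_swSeries (hV : PowerSeries.coeff 0 V = 0) :
    swMap L off V (swSeries L off V) = swSeries L off V := by
  ext1 q
  rw [(eqBelow_swSeries hV q).swMap hV coeff_zero_swSeries (coeff_zero_iterate hV q) q (by omega),
    ← Function.iterate_succ_apply' (SchriefferWolff.swMap L off V),
    eqBelow_swSeries hV (q + 1) q (by omega)]

/-- A property of coefficients that `swMap` preserves holds for its fixed point. -/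
lemma swSeries_induction (hV : PowerSeries.coeff 0 V = 0) (P : ℕ → 𝓜 → Prop) (h0 : ∀ q, P q 0)
    (hP : ∀ K, PowerSeries.coeff 0 K = 0 → (∀ q, P q (PowerSeries.coeff q K)) →
      ∀ q, P q (PowerSeries.coeff q (swMap L off V K))) (q : ℕ) :
    P q (PowerSeries.coeff q (swSeries L off V)) := by
  have : ∀ j q, P q (PowerSeries.coeff q ((swMap L off V)^[j] 0)) := by
    intro j
    induction j with
    | zero => simpa using h0
    | succ j ih =>
      rw [Function.iterate_succ_apply']
      exact hP _ (coeff_zero_iterate hV j) ih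
  rw [eqBelow_swSeries hV q q (by omega)]
  exact this q q

variable {b c : ℝ≥0}

/-- A commutator with `T` costs a factor `2 ‖T‖ ≤ 4 c ‖V‖ ≤ 1/4`. The two parts of a term start from
`‖V‖` and `2 ‖V‖`; dropping the factorials leaves `3 ‖V‖ ∑ 4^{-(m+1)} = ‖V‖`. -/
lemma tsum_frob_swTerm_le (hL : ∀ X, frob (L X) ≤ c * frob X) (hoff : ∀ X, frob (off X) ≤ frob X)
    (hc : 16 * (c * wnorm b V) ≤ 1) (K : PowerSeries 𝓜) (hK : wnorm b K ≤ 2 * wnorm b V) :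
    ∑' m, ∑' q, (b : ℝ≥0∞) ^ q * frob (swTerm L off V K m q) ≤ wnorm b V := by
  have hT : 2 * wnorm b (mapCoeff L K) ≤ 4⁻¹ := by
    calc 2 * wnorm b (mapCoeff L K) ≤ 2 * (c * (2 * wnorm b V)) := by
          gcongr
          exact (wnorm_mapCoeff_le hL K).trans (by gcongr)
      _ = 4⁻¹ * (16 * (c * wnorm b V)) := by
          rw [← mul_assoc 4⁻¹, show (16 : ℝ≥0∞) = 4 * 4 by norm_num, ← mul_assoc 4⁻¹,
            ENNReal.inv_mul_cancel (by norm_num) (by norm_num)]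
          ring
      _ ≤ 4⁻¹ * 1 := by gcongr
      _ = 4⁻¹ := mul_one _
  have ho : wnorm b (mapCoeff off K) ≤ 2 * wnorm b V := by
    refine (wnorm_mapCoeff_le (c := 1) (by simpa using hoff) K).trans ?_
    simpa using hK
  calc ∑' m, ∑' q, (b : ℝ≥0∞) ^ q * frob (swTerm L off V K m q)
      ≤ ∑' m : ℕ, (4⁻¹ : ℝ≥0∞) ^ (m + 1) * (3 * wnorm b V) := by
        refine ENNReal.tsum_le_tsum fun m => ?_
        calc ∑' q, (b : ℝ≥0∞) ^ q * frob (swTerm L off V K m q)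
            ≤ wnorm b (adIter (mapCoeff L K) V (m + 1)) +
              wnorm b (adIter (mapCoeff L K) (mapCoeff off K) (m + 1)) := by
              rw [wnorm, wnorm, ← ENNReal.tsum_add]
              refine ENNReal.tsum_le_tsum fun q => ?_
              rw [← mul_add]
              gcongr
              exact_mod_cast (frob_sub_le _ _).trans (add_le_add
                (frob_inv_natCast_smul_le (Nat.factorial_ne_zero _) _)
                (frob_inv_natCast_smul_le (Nat.factorial_ne_zero _) _))
          _ ≤ (4⁻¹) ^ (m + 1) * wnorm b V + (4⁻¹) ^ (m + 1) * (2 * wnorm b V) := by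
              refine add_le_add ((wnorm_adIter_le _ _ _).trans ?_)
                ((wnorm_adIter_le _ _ _).trans ?_) <;> gcongr
          _ = _ := by ring
    _ = wnorm b V := by
        rw [ENNReal.tsum_mul_right]
        simp only [pow_succ]
        rw [ENNReal.tsum_mul_right, ENNReal.tsum_geometric, ← mul_assoc]
        have h34 : (1 - 4⁻¹ : ℝ≥0∞)⁻¹ * 4⁻¹ * 3 = 1 := by
          rw [← ENNReal.toReal_eq_one_iff]
          rw [ENNReal.toReal_mul, ENNReal.toReal_mul, ENNReal.toReal_inv,
            ENNReal.toReal_sub_of_le (by simp) (by simp)]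
          norm_num
        rw [h34, one_mul]

lemma wnorm_swMap_le (hL : ∀ X, frob (L X) ≤ c * frob X) (hoff : ∀ X, frob (off X) ≤ frob X)
    (hc : 16 * (c * wnorm b V) ≤ 1) (K : PowerSeries 𝓜) (hK : wnorm b K ≤ 2 * wnorm b V) :
    wnorm b (swMap L off V K) ≤ 2 * wnorm b V := by
  calc wnorm b (swMap L off V K)
      ≤ ∑' q, ((b : ℝ≥0∞) ^ q * frob (PowerSeries.coeff q V) +
          ∑' m, (b : ℝ≥0∞) ^ q * frob (swTerm L off V K m q)) := by
        refine ENNReal.tsum_le_tsum fun q => ?_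
        rw [ENNReal.tsum_mul_left, ← mul_add, coeff_swMap]
        gcongr
        calc ((frob (PowerSeries.coeff q V + ∑ m ∈ Finset.range q, swTerm L off V K m q) : ℝ≥0)
              : ℝ≥0∞) ≤ (frob (PowerSeries.coeff q V) +
              ∑ m ∈ Finset.range q, frob (swTerm L off V K m q) : ℝ≥0) := by
              exact_mod_cast (frob_add_le _ _).trans (by gcongr; exact frob_sum_le _ _)
          _ ≤ _ := by
              push_cast
              gcongr
              exact ENNReal.sum_le_tsum _
    _ = wnorm b V + ∑' m, ∑' q, (b : ℝ≥0∞) ^ q * frob (swTerm L off V K m q) := by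
        rw [ENNReal.tsum_add, ENNReal.tsum_comm]
        rfl
    _ ≤ wnorm b V + wnorm b V := by
        gcongr
        exact tsum_frob_swTerm_le hL hoff hc K hK
    _ = 2 * wnorm b V := (two_mul _).symm

/-- The iterates stay in the invariant ball, and every partial sum for the fixed point is a partial
sum for some iterate. No contraction estimate is needed. -/
lemma wnorm_swSeries_le (hV : PowerSeries.coeff 0 V = 0) (hL : ∀ X, frob (L X) ≤ c * frob X)
    (hoff : ∀ X, frob (off X) ≤ frob X) (hc : 16 * (c * wnorm b V) ≤ 1) :
    wnorm b (swSeries L off V) ≤ 2 * wnorm b V := by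
  have h : ∀ j, wnorm b ((swMap L off V)^[j] 0) ≤ 2 * wnorm b V := by
    intro j
    induction j with
    | zero => simp [wnorm]
    | succ j ih =>
      rw [Function.iterate_succ_apply']
      exact wnorm_swMap_le hL hoff hc _ ih
  rw [wnorm, ENNReal.tsum_eq_iSup_nat]
  refine iSup_le fun j => ?_
  rw [Finset.sum_congr rfl fun q hq => by
    rw [eqBelow_swSeries hV j q ((Finset.mem_range.1 hq).trans (Nat.lt_succ_self j))]]
  exact (ENNReal.sum_le_tsum _).trans (h j)

end FixedPoint

/-! ### Evaluation at `ε` and the diagonalization identity. -/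

section Evaluation

variable {n : Type*} [Fintype n] [DecidableEq n]

local notation "𝓜" => Matrix n n ℂ

/-- The value of a matrix power series at `ε`. -/
def evalSeries (ε : ℝ) (f : PowerSeries (Matrix n n ℂ)) : Matrix n n ℂ :=
  ∑' q : ℕ, ε ^ q • PowerSeries.coeff q f

variable {b : ℝ≥0} {ε : ℝ}

lemma norm_pow_smul_le (hε : ‖ε‖₊ ≤ b) (q : ℕ) (X : 𝓜) :
    ‖ε ^ q • X‖ ≤ ((b ^ q * frob X : ℝ≥0) : ℝ) := by
  rw [← coe_nnnorm, NNReal.coe_le_coe, nnnorm_smul, nnnorm_pow]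
  gcongr
  exact nnnorm_le_frob X

lemma summable_of_wnorm_ne_top {f : PowerSeries 𝓜} (hf : wnorm b f ≠ ⊤) :
    Summable fun q : ℕ => b ^ q * frob (PowerSeries.coeff q f) := by
  rw [← ENNReal.tsum_coe_ne_top_iff_summable]
  simpa [wnorm] using hf

lemma summable_norm_evalSeries (hε : ‖ε‖₊ ≤ b) {f : PowerSeries 𝓜} (hf : wnorm b f ≠ ⊤) :
    Summable fun q : ℕ => ‖ε ^ q • PowerSeries.coeff q f‖ :=
  Summable.of_nonneg_of_le (fun _ => norm_nonneg _) (fun q => norm_pow_smul_le hε q _)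
    (NNReal.summable_coe.2 (summable_of_wnorm_ne_top hf))

lemma evalSeries_sub (hε : ‖ε‖₊ ≤ b) {f g : PowerSeries 𝓜} (hf : wnorm b f ≠ ⊤)
    (hg : wnorm b g ≠ ⊤) : evalSeries ε (f - g) = evalSeries ε f - evalSeries ε g := by
  simp only [evalSeries]
  rw [← (summable_norm_evalSeries hε hf).of_norm.tsum_sub (summable_norm_evalSeries hε hg).of_norm]
  simp [smul_sub]

lemma evalSeries_mul (hε : ‖ε‖₊ ≤ b) {f g : PowerSeries 𝓜} (hf : wnorm b f ≠ ⊤)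
    (hg : wnorm b g ≠ ⊤) : evalSeries ε (f * g) = evalSeries ε f * evalSeries ε g := by
  simp only [evalSeries]
  rw [tsum_mul_tsum_eq_tsum_sum_antidiagonal_of_summable_norm (summable_norm_evalSeries hε hf)
    (summable_norm_evalSeries hε hg)]
  refine tsum_congr fun q => ?_
  rw [PowerSeries.coeff_mul, Finset.smul_sum]
  refine Finset.sum_congr rfl fun p hp => ?_
  rw [← Finset.HasAntidiagonal.mem_antidiagonal.1 hp, pow_add, smul_mul_smul_comm]

lemma wnorm_adIter_ne_top {T Y : PowerSeries 𝓜} (hT : wnorm b T ≠ ⊤) (hY : wnorm b Y ≠ ⊤)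
    (m : ℕ) : wnorm b (adIter T Y m) ≠ ⊤ :=
  ne_top_of_le_ne_top (ENNReal.mul_ne_top (ENNReal.pow_ne_top
    (ENNReal.mul_ne_top (by simp) hT)) hY) (wnorm_adIter_le T Y m)

lemma evalSeries_adIter (hε : ‖ε‖₊ ≤ b) {T Y : PowerSeries 𝓜} (hT : wnorm b T ≠ ⊤)
    (hY : wnorm b Y ≠ ⊤) (m : ℕ) :
    evalSeries ε (adIter T Y m) = adIter (evalSeries ε T) (evalSeries ε Y) m := by
  induction m with
  | zero => rfl
  | succ m ih =>
    have hm := wnorm_adIter_ne_top hT hY m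
    rw [adIter_succ, adIter_succ, ← ih, evalSeries_sub hε, evalSeries_mul hε hT hm,
      evalSeries_mul hε hm hT]
    · exact ne_top_of_le_ne_top (ENNReal.mul_ne_top hT hm) (wnorm_mul_le _ _)
    · exact ne_top_of_le_ne_top (ENNReal.mul_ne_top hm hT) (wnorm_mul_le _ _)

lemma evalSeries_mapCoeff (hε : ‖ε‖₊ ≤ b) {f : PowerSeries 𝓜} (hf : wnorm b f ≠ ⊤)
    (φ : 𝓜 →ₗ[ℂ] 𝓜) : evalSeries ε (mapCoeff φ f) = φ (evalSeries ε f) := by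
  have h := (LinearMap.toContinuousLinearMap φ).map_tsum (summable_norm_evalSeries hε hf).of_norm
  simp only [LinearMap.coe_toContinuousLinearMap'] at h
  rw [evalSeries, evalSeries, h]
  refine tsum_congr fun q => ?_
  rw [coeff_mapCoeff, LinearMap.map_smul_of_tower]

variable {L off : Matrix n n ℂ →ₗ[ℂ] Matrix n n ℂ} {V : PowerSeries (Matrix n n ℂ)} {c : ℝ≥0}

lemma swTerm_eq_zero {K : PowerSeries 𝓜} (hV : PowerSeries.coeff 0 V = 0)
    (hK : PowerSeries.coeff 0 K = 0) {m q : ℕ} (h : q ≤ m) : swTerm L off V K m q = 0 := by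
  have z : ∀ φ : 𝓜 →ₗ[ℂ] 𝓜, PowerSeries.coeff 0 (mapCoeff φ K) = 0 := fun φ => by
    rw [coeff_mapCoeff, hK, map_zero]
  rw [swTerm, coeff_adIter_of_le (z L) hV (by omega), coeff_adIter_of_le (z L) (z off) (by omega)]
  simp

/-- The generator built from the fixed point of `swMap` removes the `off` part of `H₀ + V`. -/
lemma exp_conj_swSeries (hV : PowerSeries.coeff 0 V = 0) (hVb : wnorm b V ≠ ⊤)
    (hL : ∀ X, frob (L X) ≤ c * frob X) (hoff : ∀ X, frob (off X) ≤ frob X)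
    (hc : 16 * (c * wnorm b V) ≤ 1) (hε : ‖ε‖₊ ≤ b) {H₀ : 𝓜}
    (hcomm : ∀ X, L X * H₀ - H₀ * L X = -off X) {t k : 𝓜}
    (ht : t = evalSeries ε (mapCoeff L (swSeries L off V)))
    (hk : k = evalSeries ε (swSeries L off V)) :
    NormedSpace.exp t * (H₀ + evalSeries ε V) * NormedSpace.exp (-t) = H₀ + (k - off k) := by
  have hK2 := wnorm_swSeries_le hV hL hoff hc
  have hKb : wnorm b (swSeries L off V) ≠ ⊤ :=
    ne_top_of_le_ne_top (ENNReal.mul_ne_top (by simp) hVb) hK2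
  have hTb : wnorm b (mapCoeff L (swSeries L off V)) ≠ ⊤ :=
    ne_top_of_le_ne_top (ENNReal.mul_ne_top (by simp) hKb) (wnorm_mapCoeff_le hL _)
  have hOb : wnorm b (mapCoeff off (swSeries L off V)) ≠ ⊤ :=
    ne_top_of_le_ne_top (ENNReal.mul_ne_top (by simp) hKb)
      (wnorm_mapCoeff_le (c := 1) (by simpa using hoff) _)
  have htL : t = L k := by rw [ht, hk, evalSeries_mapCoeff hε hKb]
  have hok : evalSeries ε (mapCoeff off (swSeries L off V)) = off k := by
    rw [hk, evalSeries_mapCoeff hε hKb]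
  set v := evalSeries ε V with hv
  let F : ℕ → ℕ → 𝓜 := fun m q => ε ^ q • swTerm L off V (swSeries L off V) m q
  -- Absolute summability over pairs (number of commutators, order) allows the two sums to be
  -- exchanged.
  have hF : Summable (Function.uncurry F) := by
    have hG : Summable fun p : ℕ × ℕ =>
        b ^ p.2 * frob (swTerm L off V (swSeries L off V) p.1 p.2) := by
      rw [← ENNReal.tsum_coe_ne_top_iff_summable, ENNReal.tsum_prod']
      push_cast
      exact ne_top_of_le_ne_top hVb (tsum_frob_swTerm_le hL hoff hc _ hK2)
    exact Summable.of_norm_bounded (NNReal.summable_coe.2 hG)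
      fun p => norm_pow_smul_le hε p.2 _
  have hinner : ∀ m, ∑' q, F m q = ((m + 1).factorial : ℂ)⁻¹ • adIter t v (m + 1) -
      ((m + 2).factorial : ℂ)⁻¹ • adIter t (off k) (m + 1) := by
    intro m
    have s1 := (summable_norm_evalSeries hε (wnorm_adIter_ne_top hTb hVb (m + 1))).of_norm
    have s2 := (summable_norm_evalSeries hε (wnorm_adIter_ne_top hTb hOb (m + 1))).of_norm
    rw [ht, hv, ← hok, ← evalSeries_adIter hε hTb hVb, ← evalSeries_adIter hε hTb hOb, evalSeries,
      evalSeries, ← s1.tsum_const_smul, ← s2.tsum_const_smul,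
      ← (s1.const_smul _).tsum_sub (s2.const_smul _)]
    refine tsum_congr fun q => ?_
    simp only [F, swTerm, smul_sub]
    rw [smul_comm, smul_comm (ε ^ q)]
  have hkv : k = v + ∑' m, (((m + 1).factorial : ℂ)⁻¹ • adIter t v (m + 1) -
      ((m + 2).factorial : ℂ)⁻¹ • adIter t (off k) (m + 1)) := by
    simp only [← hinner]
    rw [← hF.tsum_comm, hk, hv]
    simp only [evalSeries]
    have hFs : Summable fun q => ∑' m, F m q := hF.prod_symm.prod
    rw [← (summable_norm_evalSeries hε hVb).of_norm.tsum_add hFs]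
    refine tsum_congr fun q => ?_
    conv_lhs => rw [← swMap_swSeries hV]
    rw [coeff_swMap, smul_add, Finset.smul_sum]
    congr 1
    -- The sum truncated at `m < q` in `swMap` is the full sum, the terms with `m ≥ q` being zero.
    refine (tsum_eq_sum fun m hm => ?_).symm
    rw [swTerm_eq_zero hV coeff_zero_swSeries (by simpa using hm), smul_zero]
  have e1 : HasSum (fun m : ℕ => ((m + 1).factorial : ℂ)⁻¹ • adIter t v (m + 1))
      (NormedSpace.exp t * v * NormedSpace.exp (-t) - v) := by
    have := (hasSum_nat_add_iff' 1).2 (hasSum_adIter t v)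
    simpa using this
  -- The first two terms of the expansion of `H₀` are `H₀` and `[t, H₀] = -off k`; in the others one
  -- commutator has been absorbed into `off k`, hence the factorial of `m + 2`.
  have e2 : HasSum (fun m : ℕ => -(((m + 2).factorial : ℂ)⁻¹ • adIter t (off k) (m + 1)))
      (NormedSpace.exp t * H₀ * NormedSpace.exp (-t) - (H₀ - off k)) := by
    have := (hasSum_nat_add_iff' 2).2 (hasSum_adIter t H₀)
    have h1 : t * H₀ - H₀ * t = -off k := by rw [htL, hcomm]
    simpa [Finset.sum_range_succ, adIter_succ' t H₀, h1, adIter_neg, ← sub_eq_add_neg] using this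
  have e3 : ∑' m, (((m + 1).factorial : ℂ)⁻¹ • adIter t v (m + 1) -
      ((m + 2).factorial : ℂ)⁻¹ • adIter t (off k) (m + 1)) = _ :=
    (tsum_congr fun m => sub_eq_add_neg _ _).trans (e1.add e2).tsum_eq
  rw [e3] at hkv
  rw [Matrix.mul_add, Matrix.add_mul]
  conv_rhs => enter [2, 1]; rw [hkv]
  abel

end Evaluation

/-! ### Algebras of operators supported within a set of sites. -/

section LocalAlgebra

variable {Λ : Type*} [DecidableEq Λ] {R : Finset Λ} {D : ℕ}

/-- Relabel the basis states of the site `v`. -/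
def siteAct (v : R) (e : Equiv.Perm (Fin D)) : Equiv.Perm (R → Fin D) where
  toFun σ := Function.update σ v (e (σ v))
  invFun σ := Function.update σ v (e.symm (σ v))
  left_inv σ := by simp
  right_inv σ := by simp

lemma siteAct_apply (v : R) (e : Equiv.Perm (Fin D)) (σ : R → Fin D) :
    siteAct v e σ = Function.update σ v (e (σ v)) := rfl

/-- The operators supported within `S`: off `S` they are diagonal and invariant under relabelling
the basis states. -/
def localAlgebra (S : Finset R) : Subalgebra ℂ (Op R D) where
  carrier := {X | ∀ v ∉ S, (∀ σ τ, σ v ≠ τ v → X σ τ = 0) ∧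
    ∀ e, X.submatrix (siteAct v e) (siteAct v e) = X}
  mul_mem' {X Y} hX hY v hv := by
    refine ⟨fun σ τ h => ?_, fun e => ?_⟩
    · rw [Matrix.mul_apply]
      refine Finset.sum_eq_zero fun ρ _ => ?_
      by_cases h1 : σ v = ρ v
      · rw [(hY v hv).1 ρ τ (h1 ▸ h), mul_zero]
      · rw [(hX v hv).1 σ ρ h1, zero_mul]
    · rw [← Matrix.submatrix_mul_equiv X Y _ (siteAct v e), (hX v hv).2, (hY v hv).2]
  add_mem' {X Y} hX hY v hv := by
    refine ⟨fun σ τ h => ?_, fun e => ?_⟩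
    · rw [Matrix.add_apply, (hX v hv).1 σ τ h, (hY v hv).1 σ τ h, add_zero]
    · rw [Matrix.submatrix_add, Pi.add_apply, Pi.add_apply, (hX v hv).2, (hY v hv).2]
  algebraMap_mem' r v hv := by
    refine ⟨fun σ τ h => ?_, fun e => ?_⟩
    · rw [Matrix.algebraMap_matrix_apply, if_neg]
      rintro rfl
      exact h rfl
    · ext σ τ
      simp [Matrix.algebraMap_matrix_apply]

lemma localAlgebra_mono {S S' : Finset R} (h : S ⊆ S') :
    localAlgebra (D := D) S ≤ localAlgebra S' :=
  fun _ hX v hv => hX v fun hS => hv (h hS)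

lemma apply_update_update {S : Finset R} {X : Op R D} (hX : X ∈ localAlgebra S) {v : R}
    (hv : v ∉ S) {σ τ : R → Fin D} (h : σ v = τ v) (a : Fin D) :
    X (Function.update σ v a) (Function.update τ v a) = X σ τ := by
  -- Invariance under the transposition of `σ v` and `a` moves the common value at `v` to `a`.
  conv_rhs => rw [← (hX v hv).2 (Equiv.swap (σ v) a)]
  rw [Matrix.submatrix_apply, siteAct_apply, siteAct_apply, ← h, Equiv.swap_apply_left]

lemma apply_eq_zero_of_ne {S : Finset R} {X : Op R D} (hX : X ∈ localAlgebra S) {v : R}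
    (hv : v ∉ S) {σ τ : R → Fin D} (h : σ v ≠ τ v) : X σ τ = 0 :=
  (hX v hv).1 σ τ h

lemma apply_piecewise {S : Finset R} {X : Op R D} (hX : X ∈ localAlgebra S) {σ τ : R → Fin D}
    (h : ∀ i ∉ S, σ i = τ i) (c : R → Fin D) (F : Finset R) (hF : Disjoint F S) :
    X (F.piecewise c σ) (F.piecewise c τ) = X σ τ := by
  induction F using Finset.induction_on with
  | empty => simp
  | insert v F hv ih =>
    rw [Finset.disjoint_insert_left] at hF
    rw [Finset.piecewise_insert, Finset.piecewise_insert, apply_update_update hX hF.1, ih hF.2]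
    simp [hv, h v hF.1]

lemma mem_localAlgebra_iff_supportedOn {S : Finset R} {X : Op R D} :
    X ∈ localAlgebra S ↔ SupportedOn S X := by
  constructor
  · intro hX
    rcases isEmpty_or_nonempty (R → Fin D) with h | ⟨⟨c⟩⟩
    · exact ⟨0, fun σ => h.elim σ⟩
    · refine ⟨fun s t => X (fun i => if h : i ∈ S then s ⟨i, h⟩ else c i)
        (fun i => if h : i ∈ S then t ⟨i, h⟩ else c i), fun σ τ => ?_⟩
      split_ifs with h
      · rw [← apply_piecewise hX h c Sᶜ disjoint_compl_left]
        congr 1 <;>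
        · ext1 i
          by_cases hi : i ∈ S <;> simp [hi]
      · push Not at h
        obtain ⟨v, hv, hne⟩ := h
        exact apply_eq_zero_of_ne hX hv hne
  · rintro ⟨Y, hY⟩ v hv
    refine ⟨fun σ τ h => ?_, fun e => ?_⟩
    · rw [hY, if_neg]
      exact fun h' => h (h' v hv)
    · ext σ τ
      rw [Matrix.submatrix_apply, hY, hY, siteAct_apply, siteAct_apply]
      have hr : ∀ (σ : R → Fin D) a, (fun i : S => Function.update σ v a i) = fun i : S => σ i := by
        intro σ a
        ext1 i
        rw [Function.update_of_ne]
        rintro rfl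
        exact hv i.2
      rw [hr, hr]
      refine if_congr (forall₂_congr fun i _ => ?_) rfl rfl
      by_cases hi : i = v
      · subst hi; simp
      · simp [hi]

/-- In either product a single intermediate configuration contributes: each factor is diagonal off
its support, which fixes every site. -/
lemma commute_of_disjoint {S S' : Finset R} (h : Disjoint S S') {X Y : Op R D}
    (hX : X ∈ localAlgebra S) (hY : Y ∈ localAlgebra S') : Commute X Y := by
  obtain ⟨x, hx⟩ := mem_localAlgebra_iff_supportedOn.1 hX
  obtain ⟨y, hy⟩ := mem_localAlgebra_iff_supportedOn.1 hY
  have hS : ∀ i : S, (i : R) ∉ S' := fun i => Finset.disjoint_left.1 h i.2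
  have hS' : ∀ i : S', (i : R) ∉ S := fun i => Finset.disjoint_right.1 h i.2
  ext σ τ
  rw [Matrix.mul_apply, Matrix.mul_apply,
    Finset.sum_eq_single (S'.piecewise σ τ), Finset.sum_eq_single (S'.piecewise τ σ)]
  · rw [mul_comm (Y _ _)]
    congr 1
    · rw [hx, hx]
      simp only [hS, Finset.piecewise_eq_of_notMem, not_false_eq_true]
      refine if_congr (forall₂_congr fun i _ => ?_) rfl rfl
      by_cases hi : i ∈ S' <;> simp [hi]
    · rw [hy, hy]
      simp only [Finset.coe_mem, Finset.piecewise_eq_of_mem]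
      refine if_congr (forall₂_congr fun i hi => ?_) rfl rfl
      simp [hi]
  · intro ρ _ hρ
    by_contra hne
    refine hρ (funext fun i => ?_)
    by_cases hi : i ∈ S'
    · rw [Finset.piecewise_eq_of_mem _ _ _ hi]
      by_contra hc
      exact hne (by rw [apply_eq_zero_of_ne hX (Finset.disjoint_right.1 h hi) hc, mul_zero])
    · rw [Finset.piecewise_eq_of_notMem _ _ _ hi]
      by_contra hc
      exact hne (by rw [apply_eq_zero_of_ne hY hi (Ne.symm hc), zero_mul])
  · simp
  · intro ρ _ hρ
    by_contra hne
    refine hρ (funext fun i => ?_)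
    by_cases hi : i ∈ S'
    · rw [Finset.piecewise_eq_of_mem _ _ _ hi]
      by_contra hc
      exact hne (by rw [apply_eq_zero_of_ne hX (Finset.disjoint_right.1 h hi) (Ne.symm hc),
        zero_mul])
    · rw [Finset.piecewise_eq_of_notMem _ _ _ hi]
      by_contra hc
      exact hne (by rw [apply_eq_zero_of_ne hY hi hc, mul_zero])
  · simp

end LocalAlgebra

/-! ### Range under commutators and under multipliers. -/

section LocalRange

variable {Λ : Type*} {R : Finset Λ} {D : ℕ} {G : SimpleGraph Λ}

lemma dist_le_diam {S : Finset R} {x y : R} (hx : x ∈ S) (hy : y ∈ S) :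
    G.dist (x : Λ) (y : Λ) ≤ diam G S :=
  Finset.le_sup (f := fun p : R × R => G.dist (p.1 : Λ) (p.2 : Λ)) (Finset.mk_mem_product hx hy)

lemma diam_le {S : Finset R} {r : ℕ} (h : ∀ x ∈ S, ∀ y ∈ S, G.dist (x : Λ) (y : Λ) ≤ r) :
    diam G S ≤ r :=
  Finset.sup_le fun _ hp => h _ (Finset.mem_product.1 hp).1 _ (Finset.mem_product.1 hp).2

lemma diam_mono {S S' : Finset R} (h : S ⊆ S') : diam G S ≤ diam G S' :=
  diam_le fun _ hx _ hy => dist_le_diam (h hx) (h hy)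

variable [DecidableEq Λ]

lemma diam_union_le (hG : G.Connected) {S S' : Finset R} (h : ¬Disjoint S S') :
    diam G (S ∪ S') ≤ diam G S + diam G S' := by
  obtain ⟨z, hz, hz'⟩ := Finset.not_disjoint_iff.1 h
  refine diam_le fun x hx y hy => ?_
  have ht : G.dist (x : Λ) (y : Λ) ≤ G.dist (x : Λ) z + G.dist (z : Λ) y := hG.dist_triangle
  rcases Finset.mem_union.1 hx with hx | hx <;> rcases Finset.mem_union.1 hy with hy | hy
  · exact (dist_le_diam hx hy).trans (Nat.le_add_right _ _)
  · exact ht.trans (add_le_add (dist_le_diam hx hz) (dist_le_diam hz' hy))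
  · rw [add_comm (diam G S)]
    exact ht.trans (add_le_add (dist_le_diam hx hz') (dist_le_diam hz hy))
  · exact (dist_le_diam hx hy).trans (Nat.le_add_left _ _)

variable (G R D) in
/-- The operators of range at most `m`. -/
def localRange (m : ℤ) : Submodule ℂ (Op R D) :=
  Submodule.span ℂ {X | ∃ S : Finset R, (diam G S : ℤ) ≤ m ∧ X ∈ localAlgebra S}

lemma localRange_mono {m m' : ℤ} (h : m ≤ m') : localRange R D G m ≤ localRange R D G m' :=
  Submodule.span_mono fun _ ⟨S, hS, hX⟩ => ⟨S, hS.trans h, hX⟩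

lemma mem_localRange_of_mem_localAlgebra {S : Finset R} {X : Op R D} (hX : X ∈ localAlgebra S)
    {m : ℤ} (h : (diam G S : ℤ) ≤ m) : X ∈ localRange R D G m :=
  Submodule.subset_span ⟨S, h, hX⟩

/-- Only overlapping supports fail to commute, and for these the diameter of the union is
subadditive. -/
lemma commutator_mem_localRange (hG : G.Connected) {a b : ℤ} {X Y : Op R D}
    (hX : X ∈ localRange R D G a) (hY : Y ∈ localRange R D G b) :
    X * Y - Y * X ∈ localRange R D G (a + b) := by
  induction hX using Submodule.span_induction with
  | mem X hX =>
    obtain ⟨S, hS, hX⟩ := hX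
    induction hY using Submodule.span_induction with
    | mem Y hY =>
      obtain ⟨S', hS', hY⟩ := hY
      by_cases hd : Disjoint S S'
      · rw [(commute_of_disjoint hd hX hY).eq, sub_self]
        exact Submodule.zero_mem _
      · have hX' := localAlgebra_mono (D := D) (Finset.subset_union_left : S ⊆ S ∪ S') hX
        have hY' := localAlgebra_mono (D := D) (Finset.subset_union_right : S' ⊆ S ∪ S') hY
        refine mem_localRange_of_mem_localAlgebra
          (Subalgebra.sub_mem _ (Subalgebra.mul_mem _ hX' hY') (Subalgebra.mul_mem _ hY' hX')) ?_
        have := diam_union_le (G := G) hG hd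
        omega
    | zero => simp
    | add Y Z _ _ hY hZ =>
      convert Submodule.add_mem _ hY hZ using 1
      noncomm_ring
    | smul c Y _ hY =>
      convert Submodule.smul_mem _ c hY using 1
      rw [mul_smul_comm, smul_mul_assoc, smul_sub]
  | zero => simp
  | add X Z _ _ hX hZ =>
    convert Submodule.add_mem _ hX hZ using 1
    noncomm_ring
  | smul c X _ hX =>
    convert Submodule.smul_mem _ c hX using 1
    rw [mul_smul_comm, smul_mul_assoc, smul_sub]

/-- For a commuting Hamiltonian with terms of diameter at most `k`, a multiplier in its eigenbasis
enlarges the range by at most `2 k`. -/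
lemma gapMul_mem_localRange (hG : G.Connected) {k : ℕ} {H : Op R D} (hH : H.IsHermitian)
    (hloc : IsCommutingLocal G k H) (f : ℝ → ℂ) {m : ℤ} {X : Op R D}
    (hX : X ∈ localRange R D G m) : gapMul hH f X ∈ localRange R D G (m + 2 * k) := by
  obtain ⟨h, hsupp, -, hcomm, hdiam, hsum⟩ := hloc
  induction hX using Submodule.span_induction with
  | zero => simp
  | add X Z _ _ hX hZ => rw [map_add]; exact Submodule.add_mem _ hX hZ
  | smul c X _ hX => rw [map_smul]; exact Submodule.smul_mem _ c hX
  | mem X hX =>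
    obtain ⟨S, hS, hX⟩ := hX
    classical
    -- `Γ` is `S` together with the supports of the nonzero terms that meet it; each of its points
    -- is within `k` of `S`.
    let Γ : Finset R := Finset.univ.filter fun v =>
      v ∈ S ∨ ∃ I, h I ≠ 0 ∧ ¬Disjoint I S ∧ v ∈ I
    have hΓ : ∀ v ∈ Γ, ∃ w ∈ S, G.dist (v : Λ) (w : Λ) ≤ k := by
      intro v hv
      rcases (Finset.mem_filter.1 hv).2 with hv | ⟨I, hI, hd, hv⟩
      · exact ⟨v, hv, by simp⟩
      · obtain ⟨w, hwI, hwS⟩ := Finset.not_disjoint_iff.1 hd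
        exact ⟨w, hwS, (dist_le_diam hv hwI).trans (hdiam I hI)⟩
    have hdΓ : diam G Γ ≤ diam G S + 2 * k := by
      refine diam_le fun x hx y hy => ?_
      obtain ⟨x', hx', hxx⟩ := hΓ x hx
      obtain ⟨y', hy', hyy⟩ := hΓ y hy
      have h1 : G.dist (x : Λ) y ≤ G.dist (x : Λ) x' + G.dist (x' : Λ) y := hG.dist_triangle
      have h2 : G.dist (x' : Λ) y ≤ G.dist (x' : Λ) y' + G.dist (y' : Λ) y := hG.dist_triangle
      rw [SimpleGraph.dist_comm] at hyy
      have h3 := dist_le_diam (G := G) hx' hy'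
      omega
    -- Locality in `Γ` alone is not preserved by the commutator with `H`. Requiring also commutation
    -- with all terms disjoint from `S` makes it so: those terms drop out, and the remaining ones
    -- lie in `Y` because the terms commute.
    let Y : Subalgebra ℂ (Op R D) := localAlgebra Γ ⊓
      Subalgebra.centralizer ℂ {Z | ∃ I, Disjoint I S ∧ h I = Z}
    have hY : ∀ {Z}, Z ∈ Y ↔ Z ∈ localAlgebra Γ ∧ ∀ I, Disjoint I S → h I * Z = Z * h I := by
      intro Z
      rw [Algebra.mem_inf, Subalgebra.mem_centralizer_iff]
      simp
    have hterm : ∀ I, ¬Disjoint I S → h I ∈ Y := by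
      intro I hI
      refine hY.2 ⟨?_, fun J _ => hcomm J I⟩
      by_cases h0 : h I = 0
      · rw [h0]; exact Subalgebra.zero_mem _
      · refine localAlgebra_mono ?_ (mem_localAlgebra_iff_supportedOn.2 (hsupp I))
        exact fun v hv => Finset.mem_filter.2 ⟨Finset.mem_univ v, Or.inr ⟨I, h0, hI, hv⟩⟩
    have hXY : X ∈ Y := by
      refine hY.2 ⟨localAlgebra_mono (fun v hv => ?_) hX, fun I hI => ?_⟩
      · exact Finset.mem_filter.2 ⟨Finset.mem_univ v, Or.inl hv⟩
      · exact commute_of_disjoint hI (mem_localAlgebra_iff_supportedOn.2 (hsupp I)) hX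
    have hinv : ∀ Z ∈ Subalgebra.toSubmodule Y, H * Z - Z * H ∈ Subalgebra.toSubmodule Y := by
      intro Z hZ
      rw [Subalgebra.mem_toSubmodule] at hZ
      rw [← hsum, Finset.sum_mul, Finset.mul_sum, ← Finset.sum_sub_distrib]
      refine Submodule.sum_mem _ fun I _ => ?_
      by_cases hI : Disjoint I S
      · rw [(hY.1 hZ).2 I hI, sub_self]
        exact Submodule.zero_mem _
      · exact Y.sub_mem (Y.mul_mem (hterm I hI) hZ) (Y.mul_mem hZ (hterm I hI))
    have hmem := gapMul_mem hH f _ hinv hXY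
    refine mem_localRange_of_mem_localAlgebra (hY.1 hmem).1 ?_
    omega

end LocalRange

/-! ### Orthogonal decomposition of operators by sets of sites. -/

section Components

variable {Λ : Type*} [DecidableEq Λ] {R : Finset Λ} {D : ℕ}

/-- The average over the site `v`: the normalized partial trace over `v`, tensored with `1`. -/
def siteAvg (v : R) : Op R D →ₗ[ℂ] Op R D where
  toFun X := Matrix.of fun σ τ => if σ v = τ v then
    (D : ℂ)⁻¹ * ∑ a, X (Function.update σ v a) (Function.update τ v a) else 0
  map_add' X Y := by
    ext σ τ
    by_cases h : σ v = τ v <;> simp [h, Finset.sum_add_distrib, mul_add]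
  map_smul' c X := by
    ext σ τ
    by_cases h : σ v = τ v <;> simp [h, ← Finset.mul_sum, mul_left_comm]

lemma siteAvg_apply (v : R) (X : Op R D) (σ τ : R → Fin D) : siteAvg v X σ τ =
    if σ v = τ v then (D : ℂ)⁻¹ * ∑ a, X (Function.update σ v a) (Function.update τ v a) else 0 :=
  rfl

lemma siteAvg_comm (v w : R) (X : Op R D) :
    siteAvg v (siteAvg w X) = siteAvg w (siteAvg v X) := by
  rcases eq_or_ne v w with rfl | hvw
  · rfl
  ext σ τ
  simp only [siteAvg_apply, Function.update_of_ne hvw, Function.update_of_ne hvw.symm]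
  by_cases h1 : σ v = τ v <;> by_cases h2 : σ w = τ w <;> simp only [h1, h2, if_true, if_false,
    Finset.sum_const_zero, mul_zero]
  rw [← Finset.mul_sum, ← Finset.mul_sum, Finset.sum_comm]
  simp only [Function.update_comm hvw]

lemma mem_localAlgebra_iff_siteAvg (hD : D ≠ 0) {S : Finset R} {X : Op R D} :
    X ∈ localAlgebra S ↔ ∀ v ∉ S, siteAvg v X = X := by
  have hD' : (D : ℂ) ≠ 0 := Nat.cast_ne_zero.2 hD
  constructor
  · intro hX v hv
    ext σ τ
    rw [siteAvg_apply]
    split_ifs with h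
    · rw [Finset.sum_congr rfl fun a _ => apply_update_update hX hv h a]
      simp [hD']
    · exact (apply_eq_zero_of_ne hX hv h).symm
  · intro hX v hv
    rw [← hX v hv]
    refine ⟨fun σ τ h => by rw [siteAvg_apply, if_neg h], fun e => ?_⟩
    ext σ τ
    rw [Matrix.submatrix_apply, siteAvg_apply, siteAvg_apply, siteAct_apply, siteAct_apply]
    simp

lemma siteAvg_siteAvg (hD : D ≠ 0) (v : R) (X : Op R D) :
    siteAvg v (siteAvg v X) = siteAvg v X := by
  have hD' : (D : ℂ) ≠ 0 := Nat.cast_ne_zero.2 hD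
  ext σ τ
  simp only [siteAvg_apply]
  split_ifs with h
  · simp [hD']
  · rfl

/-- Self-adjointness for the Hilbert–Schmidt product. With idempotence it makes site averaging an
orthogonal projection. -/
lemma trace_siteAvg_mul (v : R) (X Y : Op R D) :
    ((siteAvg v X)ᴴ * Y).trace = (Xᴴ * siteAvg v Y).trace := by
  have key : ∀ A B : Op R D, (Aᴴ * B).trace = ∑ σ, ∑ τ, star (A τ σ) * B τ σ := fun A B => by
    simp [Matrix.trace, Matrix.mul_apply]
  have h1 : ((siteAvg v X)ᴴ * Y).trace = (D : ℂ)⁻¹ *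
      ∑ p : ((R → Fin D) × (R → Fin D)) × Fin D with p.1.1 v = p.1.2 v,
        star (X (Function.update p.1.2 v p.2) (Function.update p.1.1 v p.2)) * Y p.1.2 p.1.1 := by
    rw [key, Finset.sum_filter, Fintype.sum_prod_type, Fintype.sum_prod_type]
    simp only [Finset.mul_sum, siteAvg_apply]
    refine Finset.sum_congr rfl fun σ _ => Finset.sum_congr rfl fun τ _ => ?_
    by_cases h : σ v = τ v
    · simp [h, Finset.sum_mul, mul_assoc]
    · simp [h, Ne.symm h]
  have h2 : (Xᴴ * siteAvg v Y).trace = (D : ℂ)⁻¹ *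
      ∑ p : ((R → Fin D) × (R → Fin D)) × Fin D with p.1.1 v = p.1.2 v,
        star (X p.1.2 p.1.1) * Y (Function.update p.1.2 v p.2) (Function.update p.1.1 v p.2) := by
    rw [key, Finset.sum_filter, Fintype.sum_prod_type, Fintype.sum_prod_type]
    simp only [Finset.mul_sum, siteAvg_apply]
    refine Finset.sum_congr rfl fun σ _ => Finset.sum_congr rfl fun τ _ => ?_
    by_cases h : σ v = τ v
    · simp [h, Finset.mul_sum, mul_left_comm]
    · simp [h, Ne.symm h]
  rw [h1, h2]
  congr 1
  -- Exchanging the summed value with the common value at `v` is an involution that matches the two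
  -- sums.
  let i : ((R → Fin D) × (R → Fin D)) × Fin D → ((R → Fin D) × (R → Fin D)) × Fin D := fun p =>
    ((Function.update p.1.1 v p.2, Function.update p.1.2 v p.2), p.1.1 v)
  have hi : ∀ p ∈ Finset.univ.filter fun p : ((R → Fin D) × (R → Fin D)) × Fin D =>
      p.1.1 v = p.1.2 v, i (i p) = p := by
    rintro ⟨⟨σ, τ⟩, a⟩ hp
    replace hp : σ v = τ v := (Finset.mem_filter.1 hp).2
    simp only [i, Function.update_self, Function.update_idem, Function.update_eq_self]
    rw [hp, Function.update_eq_self]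
  refine Finset.sum_nbij' i i (fun p _ => by simp [i]) (fun p _ => by simp [i]) hi hi ?_
  rintro ⟨⟨σ, τ⟩, a⟩ hp
  replace hp : σ v = τ v := (Finset.mem_filter.1 hp).2
  simp only [i, Function.update_idem, Function.update_eq_self]
  rw [hp, Function.update_eq_self]

lemma frob_siteAvg_sq (hD : D ≠ 0) (v : R) (X : Op R D) :
    frob (siteAvg v X) ^ 2 + frob (X - siteAvg v X) ^ 2 = frob X ^ 2 := by
  have h : ((frob (siteAvg v X) : ℝ) : ℂ) ^ 2 + ((frob (X - siteAvg v X) : ℝ) : ℂ) ^ 2 =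
      ((frob X : ℝ) : ℂ) ^ 2 := by
    rw [frob_sq_eq_trace, frob_sq_eq_trace, frob_sq_eq_trace, Matrix.conjTranspose_sub,
      Matrix.sub_mul, Matrix.mul_sub, Matrix.mul_sub]
    simp only [Matrix.trace_sub, trace_siteAvg_mul, siteAvg_siteAvg hD]
    ring
  exact_mod_cast h

lemma trace_siteAvg (hD : D ≠ 0) (v : R) (X : Op R D) : (siteAvg v X).trace = X.trace := by
  have h := trace_siteAvg_mul v (1 : Op R D) X
  rw [(mem_localAlgebra_iff_siteAvg hD (S := ∅)).1 (Subalgebra.one_mem _) v (by simp)] at h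
  simpa using h.symm

/-- The components of operators with respect to the sites in `F`. -/
lemma exists_components_of_finset (hD : D ≠ 0) (F : Finset R) :
    ∃ P : Finset R → Op R D →ₗ[ℂ] Op R D,
      (∀ X, ∑ S ∈ F.powerset, P S X = X) ∧
      (∀ X, ∑ S ∈ F.powerset, frob (P S X) ^ 2 = frob X ^ 2) ∧
      (∀ S v X, siteAvg v (P S X) = P S (siteAvg v X)) ∧
      (∀ S ⊆ F, ∀ v ∈ F, v ∉ S → ∀ X, siteAvg v (P S X) = P S X) ∧
      (∀ S ⊆ F, ∀ v ∈ S, ∀ X, siteAvg v X = X → P S X = 0) ∧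
      (∀ S ⊆ F, S.Nonempty → ∀ X, (P S X).trace = 0) := by
  induction F using Finset.induction_on with
  | empty =>
    refine ⟨fun _ => LinearMap.id, by simp, by simp, by simp, by simp, ?_, ?_⟩
    · intro S hS v hv
      exact absurd (hS hv) (by simp)
    · intro S hS h
      exact absurd (Finset.subset_empty.1 hS) h.ne_empty
  | insert w F hw ih =>
    obtain ⟨P, hsum, hsq, hcomm, hfix, hvan, htr⟩ := ih
    -- With `E_v` the average over `v`, this builds `P_S = ∏_{v ∈ S} (1 - E_v) ∏_{v ∈ F \ S} E_v`
    -- one site at a time.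
    let P' : Finset R → Op R D →ₗ[ℂ] Op R D := fun S =>
      if w ∈ S then P (S.erase w) ∘ₗ (LinearMap.id - siteAvg w) else P S ∘ₗ siteAvg w
    have hin : ∀ S X, w ∈ S → P' S X = P (S.erase w) (X - siteAvg w X) := fun S X h => by
      simp [P', h]
    have hout : ∀ S X, w ∉ S → P' S X = P S (siteAvg w X) := fun S X h => by simp [P', h]
    have hsub : ∀ S ∈ F.powerset, w ∉ S := fun S hS h => hw (Finset.mem_powerset.1 hS h)
    have hinsert : ∀ S ∈ F.powerset, ∀ X, P' (insert w S) X = P S (X - siteAvg w X) :=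
      fun S hS X => by
        rw [hin _ _ (Finset.mem_insert_self w S), Finset.erase_insert (hsub S hS)]
    have herase : ∀ {S}, S ⊆ insert w F → S.erase w ⊆ F := fun hS =>
      Finset.subset_insert_iff.1 hS
    have hmem : ∀ {S}, S ⊆ insert w F → w ∉ S → S ⊆ F := fun hS h =>
      (Finset.subset_insert_iff_of_notMem h).1 hS
    refine ⟨P', fun X => ?_, fun X => ?_, fun S v X => ?_, fun S hS v hv hvS X => ?_,
      fun S hS v hv X hX => ?_, fun S hS hne X => ?_⟩
    · rw [Finset.sum_powerset_insert hw, Finset.sum_congr rfl fun S hS => hout S X (hsub S hS),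
        Finset.sum_congr rfl fun S hS => hinsert S hS X, hsum, hsum]
      abel
    · have h1 : ∑ S ∈ F.powerset, frob (P' S X) ^ 2 = frob (siteAvg w X) ^ 2 := by
        rw [← hsq]
        exact Finset.sum_congr rfl fun S hS => by rw [hout S X (hsub S hS)]
      have h2 : ∑ S ∈ F.powerset, frob (P' (insert w S) X) ^ 2 = frob (X - siteAvg w X) ^ 2 := by
        rw [← hsq]
        exact Finset.sum_congr rfl fun S hS => by rw [hinsert S hS X]
      rw [Finset.sum_powerset_insert hw, h1, h2, frob_siteAvg_sq hD]
    · by_cases h : w ∈ S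
      · rw [hin S _ h, hin S _ h, hcomm, map_sub, siteAvg_comm v w]
      · rw [hout S _ h, hout S _ h, hcomm, siteAvg_comm v w]
    · by_cases h : w ∈ S
      · rw [hin S _ h]
        have hvw : v ≠ w := fun e => hvS (e ▸ h)
        exact hfix _ (herase hS) v (Finset.mem_of_mem_insert_of_ne hv hvw)
          (fun h' => hvS (Finset.mem_of_mem_erase h')) _
      · rw [hout S _ h]
        rcases eq_or_ne v w with rfl | hvw
        · rw [hcomm, siteAvg_siteAvg hD]
        · exact hfix _ (hmem hS h) v (Finset.mem_of_mem_insert_of_ne hv hvw) hvS _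
    · by_cases h : w ∈ S
      · rw [hin S _ h]
        rcases eq_or_ne v w with rfl | hvw
        · rw [hX, sub_self, map_zero]
        · refine hvan _ (herase hS) v (Finset.mem_erase.2 ⟨hvw, hv⟩) _ ?_
          rw [map_sub, siteAvg_comm v w, hX]
      · rw [hout S _ h]
        refine hvan _ (hmem hS h) v hv _ ?_
        rw [siteAvg_comm v w, hX]
    · by_cases h : w ∈ S
      · rw [hin S _ h, map_sub, ← hcomm, Matrix.trace_sub, trace_siteAvg hD, sub_self]
      · rw [hout S _ h]
        exact htr _ (hmem hS h) hne _

/-- Every operator is the orthogonal sum of components, one for every set of sites. -/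
lemma exists_components (hD : D ≠ 0) (R : Finset Λ) :
    ∃ P : Finset R → Op R D →ₗ[ℂ] Op R D,
      (∀ X, ∑ S, P S X = X) ∧ (∀ X, ∑ S, frob (P S X) ^ 2 = frob X ^ 2) ∧
      (∀ S X, P S X ∈ localAlgebra S) ∧
      (∀ S S' X, X ∈ localAlgebra S' → ¬S ⊆ S' → P S X = 0) ∧
      (∀ X, X.trace = 0 → P ∅ X = 0) := by
  obtain ⟨P, hsum, hsq, -, hfix, hvan, htr⟩ := exists_components_of_finset (R := R) hD Finset.univ
  rw [Finset.powerset_univ] at hsum hsq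
  have hmem : ∀ S X, P S X ∈ localAlgebra S := fun S X =>
    (mem_localAlgebra_iff_siteAvg hD).2 fun v hv =>
      hfix S (Finset.subset_univ S) v (Finset.mem_univ v) hv X
  refine ⟨P, hsum, hsq, hmem, fun S S' X hX hSS => ?_, fun X hX => ?_⟩
  · obtain ⟨v, hv, hv'⟩ := Finset.not_subset.1 hSS
    exact hvan S (Finset.subset_univ S) v hv X ((mem_localAlgebra_iff_siteAvg hD).1 hX v hv')
  -- All other components are traceless, so `P ∅ X` carries the whole trace of `X`. It is a multiple
  -- of the identity, hence zero.
  · have h0 : (P ∅ X).trace = 0 := by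
      rw [← hX]
      conv_rhs => rw [← hsum X]
      rw [Matrix.trace_sum, Finset.sum_eq_single ∅]
      · exact fun S _ hS =>
          htr S (Finset.subset_univ S) (Finset.nonempty_iff_ne_empty.2 hS) X
      · simp
    obtain ⟨y, hy⟩ := mem_localAlgebra_iff_supportedOn.1 (hmem ∅ X)
    have hy' : ∀ σ τ, P ∅ X σ τ = if σ = τ then y (fun i => isEmptyElim i) (fun i => isEmptyElim i)
        else 0 := fun σ τ => by
      rw [hy]
      refine if_congr (by simp [funext_iff]) ?_ rfl
      congr 1 <;> exact Subsingleton.elim _ _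
    have hyc : y (fun i => isEmptyElim i) (fun i => isEmptyElim i) = 0 := by
      simp only [Matrix.trace, Matrix.diag_apply, hy', if_true, Finset.sum_const,
        nsmul_eq_mul, mul_eq_zero, Finset.card_univ, Nat.cast_eq_zero] at h0
      refine h0.resolve_left ?_
      simp [hD]
    ext σ τ
    simp [hy', hyc]

end Components

/-! ### Spectral gap, dimension bound, and the inverse commutator. -/

section Spectrum

variable {n : Type*} [Fintype n] [DecidableEq n] {H : Matrix n n ℂ} (hH : H.IsHermitian)

lemma abs_eigenvalues_le (i : n) : |hH.eigenvalues i| ≤ ‖H‖ := by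
  have h := Matrix.l2_opNorm_mulVec H (hH.eigenvectorBasis i)
  rw [hH.mulVec_eigenvectorBasis, hH.eigenvectorBasis.norm_eq_one, mul_one] at h
  have h2 : ‖hH.eigenvalues i • hH.eigenvectorBasis i‖ = |hH.eigenvalues i| := by
    rw [norm_smul, hH.eigenvectorBasis.norm_eq_one, mul_one, Real.norm_eq_abs]
  rw [← h2]
  exact h

lemma minimalGap_le {i j : n} (hij : i ≠ j) :
    minimalGap hH ≤ |hH.eigenvalues i - hH.eigenvalues j| :=
  ciInf_le (Set.finite_range _).bddBelow (⟨(i, j), hij⟩ : {p : n × n // p.1 ≠ p.2})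

lemma minimalGap_pos [Nontrivial n] (hnd : IsNondegenerate hH) : 0 < minimalGap hH := by
  obtain ⟨i, j, hij⟩ := exists_pair_ne n
  have : Nonempty {p : n × n // p.1 ≠ p.2} := ⟨⟨(i, j), hij⟩⟩
  obtain ⟨p, hp⟩ := exists_eq_ciInf_of_finite
    (f := fun p : {p : n × n // p.1 ≠ p.2} => |hH.eigenvalues p.1.1 - hH.eigenvalues p.1.2|)
  rw [minimalGap, ← hp, abs_pos, sub_ne_zero]
  exact hnd.ne p.2

/-- A non-degenerate spectrum cannot be crowded: `(N - 1) Δ ≤ 2 ‖H‖`. -/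
lemma card_le_of_minimalGap_pos (hΔ : 0 < minimalGap hH) :
    (Fintype.card n : ℝ) ≤ 2 * ‖H‖ / minimalGap hH + 1 := by
  -- Cells of width equal to the gap contain at most one eigenvalue each; the cells are then
  -- counted.
  let g : n → ℤ := fun i => ⌊(hH.eigenvalues i + ‖H‖) / minimalGap hH⌋
  have hg : ∀ i, g i ∈ Finset.Icc 0 ⌊2 * ‖H‖ / minimalGap hH⌋ := by
    intro i
    have hi := abs_le.1 (abs_eigenvalues_le hH i)
    refine Finset.mem_Icc.2 ⟨Int.floor_nonneg.2 (div_nonneg (by linarith) hΔ.le),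
      Int.floor_le_floor ?_⟩
    gcongr
    linarith
  have hinj : Function.Injective g := by
    intro i j hij
    by_contra hne
    have h1 := Int.abs_sub_lt_one_of_floor_eq_floor hij
    rw [← sub_div, abs_div, abs_of_pos hΔ, div_lt_one hΔ, add_sub_add_right_eq_sub] at h1
    exact absurd (minimalGap_le hH hne) (not_le.2 h1)
  have hc : Fintype.card n ≤ (Finset.Icc 0 ⌊2 * ‖H‖ / minimalGap hH⌋).card :=
    Finset.card_le_card_of_injOn g (fun i _ => hg i) hinj.injOn
  have h0 : 0 ≤ ⌊2 * ‖H‖ / minimalGap hH⌋ := Int.floor_nonneg.2 (by positivity)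
  rw [Int.card_Icc, sub_zero] at hc
  have hc' : (Fintype.card n : ℤ) ≤ ⌊2 * ‖H‖ / minimalGap hH⌋ + 1 := by omega
  have := Int.floor_le (2 * ‖H‖ / minimalGap hH)
  have hc'' : (Fintype.card n : ℝ) ≤ (⌊2 * ‖H‖ / minimalGap hH⌋ : ℝ) + 1 := by exact_mod_cast hc'
  linarith

lemma trace_inEigenbasis (X : Matrix n n ℂ) : (inEigenbasis hH X).trace = X.trace := by
  rw [inEigenbasis, Matrix.trace_mul_cycle, eigenvectorUnitary_mul_conjTranspose, Matrix.one_mul]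

/-- Removes the diagonal in the eigenbasis of a non-degenerate `H`. -/
def offDiag : Matrix n n ℂ →ₗ[ℂ] Matrix n n ℂ :=
  gapMul hH fun x => if x = 0 then 0 else 1

/-- The inverse of the commutator with `H`. -/
def invCommutator : Matrix n n ℂ →ₗ[ℂ] Matrix n n ℂ :=
  gapMul hH fun x => (x : ℂ)⁻¹

lemma frob_offDiag_le (X : Matrix n n ℂ) : frob (offDiag hH X) ≤ frob X := by
  have := frob_gapMul_le hH (f := fun x => if x = 0 then 0 else 1) (c := 1)
    (fun i j => by split_ifs <;> simp) X
  simpa [offDiag] using this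

lemma frob_invCommutator_le {c : ℝ≥0} (hc : (c : ℝ) = (minimalGap hH)⁻¹)
    (hΔ : 0 < minimalGap hH) (X : Matrix n n ℂ) : frob (invCommutator hH X) ≤ c * frob X := by
  refine frob_gapMul_le hH (fun i j => ?_) X
  rw [← NNReal.coe_le_coe, hc, coe_nnnorm, norm_inv, Complex.norm_real, Real.norm_eq_abs]
  -- On the diagonal the multiplier is `0⁻¹ = 0`; elsewhere the gap bounds it.
  rcases eq_or_ne i j with rfl | hij
  · simpa using hΔ.le
  · exact inv_anti₀ hΔ (minimalGap_le hH hij)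

lemma invCommutator_commutator (X : Matrix n n ℂ) :
    invCommutator hH X * H - H * invCommutator hH X = -offDiag hH X := by
  rw [← neg_sub, invCommutator, commutator_gapMul, offDiag]
  congr 1
  refine gapMul_congr hH (fun i j => ?_) X
  split_ifs with h
  · simp [h]
  · exact mul_inv_cancel₀ (by exact_mod_cast h)

lemma isHermitian_offDiag {X : Matrix n n ℂ} (hX : X.IsHermitian) : (offDiag hH X).IsHermitian := by
  rw [Matrix.IsHermitian, offDiag, gapMul_conjTranspose, hX.eq]
  refine gapMul_congr hH (fun i j => ?_) X
  simp only [neg_eq_zero]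
  split_ifs <;> simp

lemma invCommutator_conjTranspose {X : Matrix n n ℂ} (hX : X.IsHermitian) :
    (invCommutator hH X)ᴴ = -invCommutator hH X := by
  rw [invCommutator, gapMul_conjTranspose, hX.eq]
  apply inEigenbasis_injective hH
  ext i j
  rw [← neg_one_smul ℂ, inEigenbasis_gapMul]
  have : inEigenbasis hH ((-1 : ℂ) • gapMul hH (fun x => (x : ℂ)⁻¹) X) i j =
      -inEigenbasis hH (gapMul hH (fun x => (x : ℂ)⁻¹) X) i j := by
    simp [inEigenbasis]
  rw [this, inEigenbasis_gapMul]
  simp only [RCLike.star_def, Complex.ofReal_neg, inv_neg, map_neg, map_inv₀,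
    Complex.conj_ofReal, neg_mul]

lemma inEigenbasis_invCommutator_diag (X : Matrix n n ℂ) (i : n) :
    inEigenbasis hH (invCommutator hH X) i i = 0 := by
  rw [invCommutator, inEigenbasis_gapMul]
  simp

lemma isDiag_inEigenbasis (hnd : IsNondegenerate hH) (X : Matrix n n ℂ) :
    (inEigenbasis hH (H + (X - offDiag hH X))).IsDiag := by
  intro i j hij
  rw [inEigenbasis_add, inEigenbasis_sub, inEigenbasis_self, Matrix.add_apply, Matrix.sub_apply,
    Matrix.diagonal_apply_ne _ hij, offDiag, inEigenbasis_gapMul,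
    if_neg (sub_ne_zero.2 (hnd.ne hij))]
  ring

end Spectrum

/-! ### From range and weighted norm to the `κ`-norm. -/

section Norms

variable {Λ : Type*} [DecidableEq Λ] {R : Finset Λ} {D : ℕ} {G : SimpleGraph Λ}

lemma isDecomposition_single (hR : R.Nonempty) (O : Op R D) :
    IsDecomposition O (Pi.single (Finset.univ : Finset R) O) := by
  have hne : (Finset.univ : Finset R) ≠ ∅ := by
    have := hR.coe_sort
    exact Finset.univ_nonempty.ne_empty
  refine ⟨fun S => ?_, Pi.single_eq_of_ne hne.symm _, by simp⟩
  rw [← mem_localAlgebra_iff_supportedOn]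
  rcases eq_or_ne S Finset.univ with rfl | hS
  · intro v hv
    simp at hv
  · rw [Pi.single_eq_of_ne hS]
    exact Subalgebra.zero_mem _

lemma mem_localRange_of_opRange_le (hR : R.Nonempty) {O : Op R D} {r : ℕ}
    (h : opRange G O ≤ r) : O ∈ localRange R D G r := by
  have hne : {r | ∃ X, IsDecomposition O X ∧ ∀ S, X S ≠ 0 → diam G S ≤ r}.Nonempty :=
    ⟨diam G Finset.univ, _, isDecomposition_single hR O,
      fun S _ => diam_mono (Finset.subset_univ S)⟩
  obtain ⟨X, ⟨hX, -, hsum⟩, hd⟩ := Nat.sInf_mem hne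
  rw [← hsum]
  refine Submodule.sum_mem _ fun S _ => ?_
  by_cases h0 : X S = 0
  · rw [h0]; exact Submodule.zero_mem _
  · exact mem_localRange_of_mem_localAlgebra (mem_localAlgebra_iff_supportedOn.2 (hX S))
      (by exact_mod_cast (hd S h0).trans h)

/-- Every non-empty set contains a site, so summing the local sums over all sites counts each term
at least once. -/
lemma norm_le_card_mul_kappaNorm (hR : R.Nonempty) (O : Op R D) :
    ‖O‖ ≤ R.card * kappaNorm G 0 O := by
  have hc : (0 : ℝ) < R.card := by exact_mod_cast hR.card_pos
  rw [← div_le_iff₀' hc]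
  have : Nonempty {X : Finset R → Op R D // IsDecomposition O X} :=
    ⟨⟨_, isDecomposition_single hR O⟩⟩
  refine le_ciInf fun ⟨X, hX, h0, hsum⟩ => ?_
  rw [div_le_iff₀' hc]
  set M := ⨆ v : R, ∑ S : Finset R with v ∈ S, Real.exp (0 * diam G S) * ‖X S‖ with hM
  calc ‖O‖ ≤ ∑ S, ‖X S‖ := hsum ▸ norm_sum_le _ _
    _ ≤ ∑ S : Finset R, ∑ v : R, if v ∈ S then ‖X S‖ else 0 := by
        refine Finset.sum_le_sum fun S _ => ?_
        rcases S.eq_empty_or_nonempty with rfl | ⟨v, hv⟩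
        · simp [h0]
        · refine le_trans ?_ (Finset.single_le_sum (fun w _ => ?_) (Finset.mem_univ v))
          · rw [if_pos hv]
          · split_ifs <;> simp
    _ = ∑ v : R, ∑ S : Finset R with v ∈ S, Real.exp (0 * diam G S) * ‖X S‖ := by
        rw [Finset.sum_comm]
        simp [Finset.sum_filter]
    _ ≤ ∑ _v : R, M := Finset.sum_le_sum fun v _ =>
        le_ciSup (f := fun v : R => ∑ S : Finset R with v ∈ S, Real.exp (0 * diam G S) * ‖X S‖)
          (Set.finite_range _).bddAbove v
    _ = R.card * M := by simp

/-- An operator supported within `S'` has components only on subsets of `S'`, whose diameter is no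
larger. -/
lemma component_eq_zero {P : Finset R → Op R D →ₗ[ℂ] Op R D}
    (hP : ∀ S S' X, X ∈ localAlgebra S' → ¬S ⊆ S' → P S X = 0) {m : ℤ} {X : Op R D}
    (hX : X ∈ localRange R D G m) {S : Finset R} (hS : m < diam G S) : P S X = 0 := by
  induction hX using Submodule.span_induction with
  | zero => simp
  | add X Y _ _ hX hY => rw [map_add, hX, hY, add_zero]
  | smul c X _ hX => rw [map_smul, hX, smul_zero]
  | mem X hX =>
    obtain ⟨S', hS', hX⟩ := hX
    refine hP S S' X hX fun h => ?_
    have := diam_mono (G := G) h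
    omega

/-- A power series whose coefficients have linearly growing range has a small `κ`-norm when its
weighted norm is small. -/
lemma kappaNorm_evalSeries_lt_one (hR : R.Nonempty) (hD : D ≠ 0) {f : PowerSeries (Op R D)}
    {c : ℕ} (hf : ∀ q : ℕ, PowerSeries.coeff q f ∈ localRange R D G (c * q)) {ε κ : ℝ} {b : ℝ≥0}
    (hε : 0 < ε) (hκ : 0 ≤ κ) (hb : Real.exp (κ * c) * ε ≤ b)
    (htr : (evalSeries ε f).trace = 0)
    (hsmall : NNReal.sqrt (2 ^ R.card) * wnorm b f < 1) :
    kappaNorm G κ (evalSeries ε f) < 1 := by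
  obtain ⟨P, hsum, hsq, hmem, hvan, h0⟩ := exists_components hD R
  have hεb : ‖ε‖₊ ≤ b := by
    rw [← NNReal.coe_le_coe, coe_nnnorm, Real.norm_of_nonneg hε.le]
    refine le_trans ?_ hb
    exact le_mul_of_one_le_left hε.le (Real.one_le_exp (by positivity))
  have hfb : wnorm b f ≠ ⊤ := by
    intro h
    rw [h, ENNReal.mul_top] at hsmall
    · exact absurd hsmall (by simp)
    · simp
  have hterm : ∀ S, ENNReal.ofReal (Real.exp (κ * diam G S) * ‖P S (evalSeries ε f)‖) ≤
      wnorm b (mapCoeff (P S) f) := by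
    intro S
    rw [ENNReal.ofReal_mul (Real.exp_pos _).le, ofReal_norm,
      ← evalSeries_mapCoeff hεb hfb, evalSeries]
    refine (mul_le_mul_right enorm_tsum_le_tsum_enorm _).trans ?_
    rw [← ENNReal.tsum_mul_left]
    refine ENNReal.tsum_le_tsum fun q => ?_
    rw [coeff_mapCoeff]
    by_cases hz : P S (PowerSeries.coeff q f) = 0
    · simp [hz]
    have hdq : diam G S ≤ c * q := by
      by_contra hlt
      exact hz (component_eq_zero hvan (hf q) (by push Not at hlt; exact_mod_cast hlt))
    -- Since only orders with `diam S ≤ c q` survive, the exponential weight is at most `e^{κ c}`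
    -- per power of `ε`.
    have hpow : Real.exp (κ * diam G S) * ε ^ q ≤ (b : ℝ) ^ q := by
      calc Real.exp (κ * diam G S) * ε ^ q ≤ Real.exp (κ * c) ^ q * ε ^ q := by
            rw [← Real.exp_nat_mul, mul_comm (q : ℝ), mul_assoc]
            have : (diam G S : ℝ) ≤ c * q := by exact_mod_cast hdq
            gcongr
        _ ≤ _ := by
            rw [← mul_pow]
            gcongr
    rw [enorm_smul, ← mul_assoc, enorm_pow, Real.enorm_of_nonneg hε.le,
      ← ENNReal.ofReal_pow hε.le, ← ENNReal.ofReal_mul (Real.exp_pos _).le]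
    refine mul_le_mul' ?_ ?_
    · rw [← ENNReal.coe_pow, ← ENNReal.ofReal_coe_nnreal]
      exact ENNReal.ofReal_le_ofReal (by exact_mod_cast hpow)
    · exact ENNReal.coe_le_coe.2 (nnnorm_le_frob _)
  -- Cauchy–Schwarz over the `2^{V_*}` orthogonal components.
  have hfrob : ∀ X : Op R D, ∑ S, frob (P S X) ≤ NNReal.sqrt (2 ^ R.card) * frob X := by
    intro X
    rw [← NNReal.sqrt_sq (frob X), ← NNReal.sqrt_mul, NNReal.le_sqrt_iff_sq_le, ← hsq X]
    have h := sq_sum_le_card_mul_sum_sq (s := (Finset.univ : Finset (Finset R)))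
      (f := fun S => frob (P S X))
    simpa using h
  have htotal : ∑ S, Real.exp (κ * diam G S) * ‖P S (evalSeries ε f)‖ < 1 := by
    rw [← ENNReal.ofReal_lt_one, ENNReal.ofReal_sum_of_nonneg fun S _ => by positivity]
    calc _ ≤ ∑ S, wnorm b (mapCoeff (P S) f) := Finset.sum_le_sum fun S _ => hterm S
      _ = ∑' q, ∑ S, (b : ℝ≥0∞) ^ q * frob (P S (PowerSeries.coeff q f)) := by
          rw [Summable.tsum_finsetSum fun _ _ => ENNReal.summable]
          simp only [wnorm, coeff_mapCoeff]
      _ ≤ ∑' q, NNReal.sqrt (2 ^ R.card) * ((b : ℝ≥0∞) ^ q * frob (PowerSeries.coeff q f)) := by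
          refine ENNReal.tsum_le_tsum fun q => ?_
          rw [← Finset.mul_sum, mul_left_comm]
          gcongr
          exact_mod_cast hfrob _
      _ = NNReal.sqrt (2 ^ R.card) * wnorm b f := ENNReal.tsum_mul_left
      _ < 1 := hsmall
  -- A decomposition may not use the empty set; the vanishing trace removes that component.
  have hdec : IsDecomposition (evalSeries ε f) fun S => P S (evalSeries ε f) :=
    ⟨fun S => mem_localAlgebra_iff_supportedOn.1 (hmem S _), h0 _ htr, hsum _⟩
  have hne := hR.coe_sort
  refine lt_of_le_of_lt ((ciInf_le ⟨0, ?_⟩ ⟨_, hdec⟩).trans (ciSup_le fun v => ?_)) htotal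
  · rintro _ ⟨X, rfl⟩
    exact Real.iSup_nonneg fun _ => by positivity
  · exact Finset.sum_le_sum_of_subset_of_nonneg (Finset.filter_subset _ _)
      fun S _ _ => by positivity

end Norms

/-! ### Hermiticity and range of the coefficients. -/

section SeriesCoefficients

lemma coeff_commutator {𝔸 : Type*} [Ring 𝔸] (T Y : PowerSeries 𝔸) (q : ℕ) :
    PowerSeries.coeff q (T * Y - Y * T) = ∑ p ∈ Finset.HasAntidiagonal.antidiagonal q,
      (PowerSeries.coeff p.1 T * PowerSeries.coeff p.2 Y -
        PowerSeries.coeff p.2 Y * PowerSeries.coeff p.1 T) := by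
  rw [map_sub, PowerSeries.coeff_mul, PowerSeries.coeff_mul, Finset.sum_sub_distrib,
    ← Finset.Nat.sum_antidiagonal_swap
      (f := fun p => PowerSeries.coeff p.1 Y * PowerSeries.coeff p.2 T)]
  rfl

lemma isHermitian_coeff_adIter {n : Type*} [Fintype n] [DecidableEq n]
    {T Y : PowerSeries (Matrix n n ℂ)}
    (hT : ∀ q, (PowerSeries.coeff q T)ᴴ = -PowerSeries.coeff q T)
    (hY : ∀ q, (PowerSeries.coeff q Y).IsHermitian) (m q : ℕ) :
    (PowerSeries.coeff q (adIter T Y m)).IsHermitian := by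
  induction m generalizing q with
  | zero => exact hY q
  | succ m ih =>
    rw [adIter_succ, coeff_commutator, Matrix.IsHermitian, Matrix.conjTranspose_sum]
    refine Finset.sum_congr rfl fun p _ => ?_
    rw [Matrix.conjTranspose_sub, Matrix.conjTranspose_mul, Matrix.conjTranspose_mul, hT, (ih _).eq]
    noncomm_ring

variable {Λ : Type*} [DecidableEq Λ] {R : Finset Λ} {D : ℕ} {G : SimpleGraph Λ}

lemma coeff_adIter_mem_localRange (hG : G.Connected) {c d d' : ℤ} {T Y : PowerSeries (Op R D)}
    (hT : ∀ q : ℕ, PowerSeries.coeff q T ∈ localRange R D G (c * q - d))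
    (hY : ∀ q : ℕ, PowerSeries.coeff q Y ∈ localRange R D G (c * q - d')) (m q : ℕ) :
    PowerSeries.coeff q (adIter T Y m) ∈ localRange R D G (c * q - m * d - d') := by
  induction m generalizing q with
  | zero => simpa using hY q
  | succ m ih =>
    rw [adIter_succ, coeff_commutator]
    refine Submodule.sum_mem _ fun p hp => ?_
    have h := commutator_mem_localRange hG (hT p.1) (ih p.2)
    rw [← Finset.HasAntidiagonal.mem_antidiagonal.1 hp]
    convert h using 2
    push_cast
    ring

/-- The coefficients of the fixed point are Hermitian, with linearly growing range. -/
lemma coeff_swSeries_mem (hG : G.Connected) {k : ℕ} {H : Op R D} (hH : H.IsHermitian)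
    (hloc : IsCommutingLocal G k H) {V : PowerSeries (Op R D)}
    (hV0 : PowerSeries.coeff 0 V = 0) (hV : ∀ q, (PowerSeries.coeff q V).IsHermitian)
    (hVr : ∀ q : ℕ, PowerSeries.coeff q V ∈ localRange R D G q) (q : ℕ) :
    (PowerSeries.coeff q (swSeries (invCommutator hH) (offDiag hH) V)).IsHermitian ∧
    PowerSeries.coeff q (swSeries (invCommutator hH) (offDiag hH) V) ∈
      localRange R D G ((5 * k + 1) * q - 5 * k) := by
  -- At `q = 1` the bound is exactly the range `1` allowed for `V₁`. At `q = 0` it is `-5k`, whence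
  -- integer ranges and the separate use of the vanishing constant term.
  have hVr' : ∀ q : ℕ, PowerSeries.coeff q V ∈ localRange R D G ((5 * k + 1) * q - 5 * k) := by
    intro q
    rcases Nat.eq_zero_or_pos q with rfl | hq
    · rw [hV0]; exact Submodule.zero_mem _
    · refine localRange_mono ?_ (hVr q)
      have hq' : (1 : ℤ) ≤ q := by exact_mod_cast hq
      nlinarith
  refine swSeries_induction hV0 (fun q X => X.IsHermitian ∧
    X ∈ localRange R D G ((5 * k + 1) * q - 5 * k)) ?_ ?_ q
  · exact fun q => ⟨Matrix.isHermitian_zero, Submodule.zero_mem _⟩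
  · intro K _ hK q
    have hgap : ∀ (f : ℝ → ℂ) (q : ℕ), PowerSeries.coeff q (mapCoeff (gapMul hH f) K) ∈
        localRange R D G ((5 * k + 1) * q - 3 * k) := by
      intro f q
      rw [coeff_mapCoeff]
      have := gapMul_mem_localRange hG hH hloc f (hK q).2
      convert this using 2
      ring
    have hT : ∀ q, (PowerSeries.coeff q (mapCoeff (invCommutator hH) K))ᴴ =
        -PowerSeries.coeff q (mapCoeff (invCommutator hH) K) := fun q => by
      rw [coeff_mapCoeff, invCommutator_conjTranspose hH (hK q).1]
    have hO : ∀ q, (PowerSeries.coeff q (mapCoeff (offDiag hH) K)).IsHermitian := fun q => by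
      rw [coeff_mapCoeff]
      exact isHermitian_offDiag hH (hK q).1
    have hstar : ∀ r : ℕ, star ((r : ℂ)⁻¹) = (r : ℂ)⁻¹ := by simp
    rw [coeff_swMap]
    constructor
    · rw [Matrix.IsHermitian, Matrix.conjTranspose_add, (hV q).eq, Matrix.conjTranspose_sum]
      congr 1
      refine Finset.sum_congr rfl fun m _ => ?_
      rw [swTerm, Matrix.conjTranspose_sub, Matrix.conjTranspose_smul, Matrix.conjTranspose_smul,
        (isHermitian_coeff_adIter hT hV _ _).eq, (isHermitian_coeff_adIter hT hO _ _).eq,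
        hstar, hstar]
    · refine Submodule.add_mem _ (hVr' q) (Submodule.sum_mem _ fun m _ => ?_)
      refine Submodule.sub_mem _ (Submodule.smul_mem _ _ ?_) (Submodule.smul_mem _ _ ?_)
      -- After a multiplier the offset `5k` has shrunk to `3k`. Offsets add under commutators,
      -- giving at least `3k + 5k` here and `3k + 3k` in the other term, so `5k` is recovered.
      · refine localRange_mono ?_ (coeff_adIter_mem_localRange hG (hgap _) hVr' (m + 1) q)
        push_cast
        nlinarith [mul_nonneg (Int.natCast_nonneg m) (Int.natCast_nonneg k)]
      · refine localRange_mono ?_ (coeff_adIter_mem_localRange hG (hgap _) (hgap _) (m + 1) q)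
        push_cast
        nlinarith [mul_nonneg (Int.natCast_nonneg m) (Int.natCast_nonneg k)]

end SeriesCoefficients

/-! ### Series indexed by positive orders, unitarity, and constants. -/

section Assembly

variable {n : Type*}

/-- The formal power series with coefficients `X_q`, `q ≥ 1`, and no constant term. -/
def toSeries (X : ℕ+ → Matrix n n ℂ) [Fintype n] [DecidableEq n] : PowerSeries (Matrix n n ℂ) :=
  PowerSeries.mk fun q => if h : 0 < q then X ⟨q, h⟩ else 0

variable [Fintype n] [DecidableEq n]

lemma coeff_zero_toSeries (X : ℕ+ → Matrix n n ℂ) : PowerSeries.coeff 0 (toSeries X) = 0 := by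
  rw [toSeries, PowerSeries.coeff_mk, dif_neg (lt_irrefl 0)]

lemma coeff_toSeries (X : ℕ+ → Matrix n n ℂ) (q : ℕ+) :
    PowerSeries.coeff (q : ℕ) (toSeries X) = X q := by
  rw [toSeries, PowerSeries.coeff_mk, dif_pos q.pos]
  rfl

lemma forall_coeff_toSeries {X : ℕ+ → Matrix n n ℂ} {p : ℕ → Matrix n n ℂ → Prop} (h0 : p 0 0)
    (h : ∀ q : ℕ+, p q (X q)) (q : ℕ) : p q (PowerSeries.coeff q (toSeries X)) := by
  rcases Nat.eq_zero_or_pos q with rfl | hq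
  · rwa [coeff_zero_toSeries]
  · have := coeff_toSeries X ⟨q, hq⟩
    rw [PNat.mk_coe] at this
    rw [this]
    exact h ⟨q, hq⟩

lemma powerSeries_eq_evalSeries {X : ℕ+ → Matrix n n ℂ} {f : PowerSeries (Matrix n n ℂ)}
    (h0 : PowerSeries.coeff 0 f = 0) (h : ∀ q : ℕ+, PowerSeries.coeff (q : ℕ) f = X q) (ε : ℝ) :
    powerSeries X ε = evalSeries ε f := by
  rw [evalSeries, ← tsum_pnat_eq_tsum_of_eq_zero (by rw [h0, smul_zero]), powerSeries]
  simp only [h]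

lemma wnorm_toSeries_le {X : ℕ+ → Matrix n n ℂ} {x : ℕ+ → ℝ} (hX : ∀ r, ‖X r‖ ≤ x r)
    (hx : Summable x) {b : ℝ≥0} (hb : b ≤ 1) :
    wnorm b (toSeries X) ≤
      ENNReal.ofReal (b * (Real.sqrt (Fintype.card n) * ∑' r, x r)) := by
  have hx0 : ∀ r, 0 ≤ x r := fun r => (norm_nonneg _).trans (hX r)
  rw [wnorm, ← tsum_pnat_eq_tsum_of_eq_zero (by rw [coeff_zero_toSeries]; simp),
    ← tsum_mul_left, ← tsum_mul_left, ENNReal.ofReal_tsum_of_nonneg (fun r => by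
      have := hx0 r; positivity) ((hx.mul_left _).mul_left _)]
  refine ENNReal.tsum_le_tsum fun r => ?_
  rw [coeff_toSeries, ← ENNReal.coe_pow, ← ENNReal.coe_mul, ← ENNReal.ofReal_coe_nnreal]
  refine ENNReal.ofReal_le_ofReal ?_
  push_cast
  refine mul_le_mul ?_ ?_ (NNReal.coe_nonneg _) (NNReal.coe_nonneg _)
  · exact pow_le_of_le_one b.2 hb r.ne_zero
  · have h := NNReal.coe_le_coe.2 (frob_le_sqrt_card (X r))
    push_cast at h
    exact h.trans (by gcongr; exact hX r)

lemma evalSeries_conjTranspose_of_antiHermitian {f : PowerSeries (Matrix n n ℂ)}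
    (hf : ∀ q, (PowerSeries.coeff q f)ᴴ = -PowerSeries.coeff q f) (ε : ℝ) :
    (evalSeries ε f)ᴴ = -evalSeries ε f := by
  rw [evalSeries, Matrix.conjTranspose_tsum, ← tsum_neg]
  refine tsum_congr fun q => ?_
  rw [Matrix.conjTranspose_smul, hf, smul_neg]
  simp

lemma exp_mem_unitaryGroup {T : Matrix n n ℂ} (hT : Tᴴ = -T) :
    NormedSpace.exp T ∈ Matrix.unitaryGroup n ℂ := by
  let _ : NormedAlgebra ℚ (Matrix n n ℂ) := .restrictScalars ℚ ℂ _
  exact NormedSpace.exp_mem_unitary_of_mem_skewAdjoint (skewAdjoint.mem_iff.2 hT)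

/-- Here `x = V_* h / Δ`. From `N ≥ 2` follows `x ≥ 1/2`, hence `N ≤ 4x` and `16 N x ≤ 64 x²`, while
`π² ≥ 9` gives `A ≥ 288 x²`. -/
lemma schriefferWolff_constants {N x A : ℝ} (hN : 2 ≤ N) (hx : N ≤ 2 * x + 1)
    (hA : A = 32 * Real.pi ^ 2 * x ^ 2) : 1 ≤ A ∧ N * x / A ≤ 1 / 16 := by
  have hx2 : 1 / 2 ≤ x := by linarith
  have hpi : 9 ≤ Real.pi ^ 2 := by nlinarith [Real.pi_gt_three]
  have hA9 : 288 * x ^ 2 ≤ A := by rw [hA]; nlinarith [sq_nonneg x]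
  have hA1 : 1 ≤ A := by nlinarith
  refine ⟨hA1, ?_⟩
  rw [div_le_div_iff₀ (by linarith) (by norm_num)]
  nlinarith

end Assembly

end SchriefferWolff

/-! ### Proof of the theorem. -/

open SchriefferWolff in
open scoped NNReal ENNReal in
theorem mainTheorem4 {Λ : Type*} [DecidableEq Λ] (G : SimpleGraph Λ) (hG : G.Connected)
    (R : Finset Λ) (hR : R.Nonempty) (D : ℕ) (hD : 2 ≤ D) (k : ℕ) (h : ℝ)
    (H₀ : SchriefferWolff.Op R D) (hH₀ : H₀.IsHermitian)
    (hloc : SchriefferWolff.IsCommutingLocal G k H₀)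
    (hnd : SchriefferWolff.IsNondegenerate hH₀)
    (hH₀h : SchriefferWolff.kappaNorm G 0 H₀ ≤ h)
    (V : ℕ+ → SchriefferWolff.Op R D) (hV : ∀ r, (V r).IsHermitian)
    (hVrange : ∀ r : ℕ+, SchriefferWolff.opRange G (V r) ≤ (r : ℕ))
    (hVsum : Summable fun r => SchriefferWolff.kappaNorm G 0 (V r))
    (hVh : ∑' r, SchriefferWolff.kappaNorm G 0 (V r) ≤ h)
    (A : ℝ)
    (hA : A = 32 * Real.pi ^ 2 * ((R.card : ℝ) * h / SchriefferWolff.minimalGap hH₀) ^ 2) :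
    ∃ T : ℕ+ → SchriefferWolff.Op R D,
      (∀ q σ, SchriefferWolff.inEigenbasis hH₀ (T q) σ σ = 0) ∧
      ∀ ε : ℝ, 0 < ε → A * ε ≤ 1 →
        (Summable fun r : ℕ+ => ‖ε ^ (r : ℕ) • V r‖) ∧
        (Summable fun q : ℕ+ => ‖ε ^ (q : ℕ) • T q‖) ∧
        (SchriefferWolff.powerSeries T ε)ᴴ = -SchriefferWolff.powerSeries T ε ∧
        NormedSpace.exp (SchriefferWolff.powerSeries T ε) ∈
          Matrix.unitaryGroup (R → Fin D) ℂ ∧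
        (SchriefferWolff.inEigenbasis hH₀
          (NormedSpace.exp (SchriefferWolff.powerSeries T ε) *
            (H₀ + SchriefferWolff.powerSeries V ε) *
            NormedSpace.exp (-SchriefferWolff.powerSeries T ε))).IsDiag ∧
        SchriefferWolff.kappaNorm G (Real.log (1 / (A * ε)) / (5 * (k : ℝ) + 1))
          (SchriefferWolff.powerSeries T ε) < 1 := by
  have hcard : Fintype.card (R → Fin D) = D ^ R.card := by simp
  have hN2 : 2 ^ R.card ≤ Fintype.card (R → Fin D) := hcard ▸ Nat.pow_le_pow_left hD _
  have hN : 2 ≤ Fintype.card (R → Fin D) :=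
    (Nat.le_self_pow hR.card_pos.ne' 2).trans hN2
  have hnt : Nontrivial (R → Fin D) := Fintype.one_lt_card_iff_nontrivial.1 hN
  have hΔ := minimalGap_pos hH₀ hnd
  set Δ := minimalGap hH₀ with hΔdef
  have hH₀s : ‖H₀‖ ≤ R.card * h :=
    (norm_le_card_mul_kappaNorm hR H₀).trans (by gcongr)
  have hNx : (Fintype.card (R → Fin D) : ℝ) ≤ 2 * (R.card * h / Δ) + 1 := by
    refine (card_le_of_minimalGap_pos hH₀ hΔ).trans ?_
    rw [← mul_div_assoc]
    gcongr
  obtain ⟨hA1, hAx⟩ := schriefferWolff_constants (by exact_mod_cast hN) hNx hA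
  have hA0 : 0 < A := by linarith
  obtain ⟨b, hb⟩ : ∃ b : ℝ≥0, (b : ℝ) = A⁻¹ := ⟨⟨A⁻¹, by positivity⟩, rfl⟩
  obtain ⟨c, hc⟩ : ∃ c : ℝ≥0, (c : ℝ) = Δ⁻¹ := ⟨⟨Δ⁻¹, by positivity⟩, rfl⟩
  have hb1 : b ≤ 1 := by
    rw [← NNReal.coe_le_coe, hb]
    exact inv_le_one_of_one_le₀ hA1
  set VS := toSeries V with hVS
  have hV0 : PowerSeries.coeff 0 VS = 0 := coeff_zero_toSeries V
  have hVw : wnorm b VS ≤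
      ENNReal.ofReal (b * (Real.sqrt (Fintype.card (R → Fin D)) * (R.card * h))) := by
    refine (wnorm_toSeries_le (fun r => norm_le_card_mul_kappaNorm (G := G) hR (V r))
      (hVsum.mul_left _) hb1).trans (ENNReal.ofReal_le_ofReal ?_)
    rw [tsum_mul_left]
    gcongr
  have hVb : wnorm b VS ≠ ⊤ := ne_top_of_le_ne_top ENNReal.ofReal_ne_top hVw
  -- One `√N` is reserved for the sum over components, the other is in the norm of `V`; together
  -- they give `N x / A`. The fixed-point condition `hc16` needs only the weaker bound without the
  -- first.
  have hsmall : (NNReal.sqrt (Fintype.card (R → Fin D)) : ℝ≥0∞) * (c * wnorm b VS) ≤ 16⁻¹ := by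
    calc _ ≤ (NNReal.sqrt (Fintype.card (R → Fin D)) : ℝ≥0∞) * (c * ENNReal.ofReal
          (b * (Real.sqrt (Fintype.card (R → Fin D)) * (R.card * h)))) := by gcongr
      _ = ENNReal.ofReal ((Fintype.card (R → Fin D)) * (R.card * h / Δ) / A) := by
        rw [← ENNReal.ofReal_coe_nnreal, ← ENNReal.ofReal_coe_nnreal,
          ← ENNReal.ofReal_mul (NNReal.coe_nonneg _), ← ENNReal.ofReal_mul (NNReal.coe_nonneg _),
          hb, hc]
        congr 1
        push_cast
        calc _ = (Real.sqrt (Fintype.card (R → Fin D)) * Real.sqrt (Fintype.card (R → Fin D))) *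
              (R.card * h / Δ) / A := by ring
          _ = _ := by rw [Real.mul_self_sqrt (Nat.cast_nonneg _)]
      _ ≤ ENNReal.ofReal (1 / 16) := ENNReal.ofReal_le_ofReal hAx
      _ = 16⁻¹ := by
        rw [one_div, ENNReal.ofReal_inv_of_pos (by norm_num)]
        norm_num
  have hc16 : 16 * (c * wnorm b VS) ≤ 1 := by
    have h1 : (1 : ℝ≥0∞) ≤ NNReal.sqrt (Fintype.card (R → Fin D)) := by
      rw [← ENNReal.coe_one, ENNReal.coe_le_coe, NNReal.le_sqrt_iff_sq_le, one_pow]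
      exact_mod_cast (by omega : 1 ≤ Fintype.card (R → Fin D))
    calc 16 * (c * wnorm b VS)
        ≤ 16 * (NNReal.sqrt (Fintype.card (R → Fin D)) * (c * wnorm b VS)) := by
          exact mul_le_mul_right (le_mul_of_one_le_left (zero_le) h1) 16
      _ ≤ 16 * 16⁻¹ := by gcongr
      _ = 1 := ENNReal.mul_inv_cancel (by norm_num) (by norm_num)
  have hL := frob_invCommutator_le hH₀ hc hΔ
  have hoff := frob_offDiag_le hH₀
  set KS := swSeries (invCommutator hH₀) (offDiag hH₀) VS with hKS
  have hKw : wnorm b KS ≤ 2 * wnorm b VS := wnorm_swSeries_le hV0 hL hoff hc16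
  have hKb : wnorm b KS ≠ ⊤ := ne_top_of_le_ne_top (ENNReal.mul_ne_top (by simp) hVb) hKw
  set TS := mapCoeff (invCommutator hH₀) KS with hTS
  have hTw : wnorm b TS ≤ c * wnorm b KS := wnorm_mapCoeff_le hL _
  have hTb : wnorm b TS ≠ ⊤ := ne_top_of_le_ne_top (ENNReal.mul_ne_top (by simp) hKb) hTw
  have hT0 : PowerSeries.coeff 0 TS = 0 := by
    rw [hTS, coeff_mapCoeff, hKS, coeff_zero_swSeries, map_zero]
  have hK := coeff_swSeries_mem hG hH₀ hloc hV0
    (forall_coeff_toSeries (p := fun _ X => X.IsHermitian) Matrix.isHermitian_zero hV)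
    (forall_coeff_toSeries (p := fun q X => X ∈ localRange R D G q) (Submodule.zero_mem _)
      fun q => mem_localRange_of_opRange_le hR (hVrange q))
  have hTanti : ∀ q, (PowerSeries.coeff q TS)ᴴ = -PowerSeries.coeff q TS := fun q => by
    rw [hTS, coeff_mapCoeff, invCommutator_conjTranspose hH₀ (hK q).1]
  have hTrange : ∀ q : ℕ, PowerSeries.coeff q TS ∈ localRange R D G ((5 * k + 1 : ℕ) * q) := by
    intro q
    rw [hTS, coeff_mapCoeff]
    refine localRange_mono ?_ (gapMul_mem_localRange hG hH₀ hloc _ (hK q).2)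
    push_cast
    omega
  refine ⟨fun q => PowerSeries.coeff (q : ℕ) TS, fun q σ => ?_, fun ε hε hAε => ?_⟩
  · change inEigenbasis hH₀ (PowerSeries.coeff (q : ℕ) TS) σ σ = 0
    rw [hTS, coeff_mapCoeff, inEigenbasis_invCommutator_diag]
  have hεA : ε ≤ A⁻¹ := by rwa [← one_div, le_div_iff₀' hA0]
  have hεb : ‖ε‖₊ ≤ b := by
    rw [← NNReal.coe_le_coe, coe_nnnorm, Real.norm_of_nonneg hε.le, hb]
    exact hεA
  have hVeval : powerSeries V ε = evalSeries ε VS :=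
    powerSeries_eq_evalSeries hV0 (coeff_toSeries V) ε
  have hTeval : powerSeries (fun q : ℕ+ => PowerSeries.coeff (q : ℕ) TS) ε = evalSeries ε TS :=
    powerSeries_eq_evalSeries hT0 (fun _ => rfl) ε
  have hanti : (evalSeries ε TS)ᴴ = -evalSeries ε TS :=
    evalSeries_conjTranspose_of_antiHermitian hTanti ε
  rw [hTeval, hVeval]
  refine ⟨?_, ?_, hanti, exp_mem_unitaryGroup hanti, ?_, ?_⟩
  · have := (summable_norm_evalSeries hεb hVb).comp_injective PNat.coe_injective
    simpa only [Function.comp_def, hVS, coeff_toSeries] using this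
  · exact (summable_norm_evalSeries hεb hTb).comp_injective PNat.coe_injective
  · rw [exp_conj_swSeries hV0 hVb hL hoff hc16 hεb (invCommutator_commutator hH₀) rfl rfl]
    exact isDiag_inEigenbasis hH₀ hnd _
  · have hAε0 : 0 < A * ε := mul_pos hA0 hε
    have hk : (0 : ℝ) < 5 * k + 1 := by positivity
    refine kappaNorm_evalSeries_lt_one (b := b) hR (by omega) hTrange hε
      (div_nonneg (Real.log_nonneg (by rwa [le_div_iff₀ hAε0, one_mul])) hk.le) (le_of_eq ?_) ?_ ?_
    -- The choice of `κ` gives `e^{κ (5k+1)} ε = (Aε)⁻¹ ε = A⁻¹`, exactly the weight `b`.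
    · push_cast
      rw [div_mul_cancel₀ _ hk.ne', Real.exp_log (by positivity), hb]
      field_simp
    · rw [hTS, evalSeries_mapCoeff hεb hKb, ← trace_inEigenbasis hH₀]
      exact Finset.sum_eq_zero fun σ _ => inEigenbasis_invCommutator_diag hH₀ _ σ
    · calc (NNReal.sqrt (2 ^ R.card) : ℝ≥0∞) * wnorm b TS
          ≤ NNReal.sqrt (Fintype.card (R → Fin D)) * (c * (2 * wnorm b VS)) := by
            gcongr
            · exact_mod_cast hN2
            · exact hTw.trans (by gcongr)
        _ = 2 * (NNReal.sqrt (Fintype.card (R → Fin D)) * (c * wnorm b VS)) := by ring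
        _ ≤ 2 * 16⁻¹ := by gcongr
        _ < 1 := by
            rw [← div_eq_mul_inv]
            exact ENNReal.div_lt_of_lt_mul (by norm_num)

end
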